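/- Work over $\mathbb{Q}(q,t)$ with its $t$-adic topology. Let $\mathscr{P}_n^+=\mathbb{Q}(q,t)[x_1,\dots,x_n]$, let $\mathscr{P}_\infty^+$ be the inverse limit of the rings $\mathscr{P}_n^+$ along the maps $x_{n+1}\mapsto 0$, with projections $\pi_n:\mathscr{P}_\infty^+\to\mathscr{P}_n^+$, let $\Lambda=\mathbb{Q}(q,t)[p_1,p_2,\dots]$ be the ring of symmetric functions, and let $$\mathscr{P}(k)^+=\mathbb{Q}(q,t)[x_1,\dots,x_k]\otimes\Lambda[x_{k+1}+x_{k+2}+\cdots]\subset\mathscr{P}_\infty^+,\qquad \mathscr{P}_{as}^+=\bigcup_{k\ge 0}\mathscr{P}(k)^+ .$$ *Partial trivial idempotents.* On $\mathscr{P}_n^+$ let $T_if=s_if+(1-t)x_i\frac{f-s_if}{x_i-x_{i+1}}$ for $1\le i\le n-1$, where $s_i$ swaps $x_i$ and $x_{i+1}$, and $T_\sigma=T_{i_1}\cdots T_{i_r}$ for a reduced word $\sigma=s_{i_1}\cdots s_{i_r}$. For $0\le \ell<n$ let $$\epsilon_\ell^{(n)}(f)=\frac{1}{[n-\ell]_t!}\sum_{\sigma\in\mathfrak{S}_{(1^\ell,n-\ell)}}t^{\binom{n-\ell}{2}-\ell(\sigma)}\,T_\sigma(f),\qquad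 [m]_t!=\prod_{i=1}^m\frac{1-t^i}{1-t},$$ where $\mathfrak{S}_{(1^\ell,n-\ell)}\subset\mathfrak{S}_n$ is the subgroup fixing $1,\dots,\ell$ and $\ell(\sigma)$ is the Coxeter length of $\sigma$. *Convergence.* A sequence $f_m\in\mathscr{P}_m^+$ $(m>\ell)$ converges to $F$ if there are $N$, $h\in\mathscr{P}_\infty^+$, $g_1,\dots,g_N\in\mathscr{P}_{as}^+$ and scalar sequences $a_i(m)$ converging $t$-adically to $c_i\in\mathbb{Q}(q,t)$ such that $f_m=\pi_m(h)+\sum_i a_i(m)\pi_m(g_i)$ for all $m>\ell$ and $F=h+\sum_i c_ig_i$. An operator $A$ on $\mathscr{P}_{as}^+$ is the limit of operators $A_m$ on $\mathscr{P}_m^+$ $(m>\ell)$ if $A_m(\pi_m(f))$ converges to $A(f)$ for every $f\in\mathscr{P}_{as}^+$. *Stable symmetrization.* For $n\ge 0$ let $\mathscr{B}_n(F)=\langle z^n\rangle F[X-z^{-1}]\,\mathrm{Exp}[(1-t)zX]$ on $\Lambda$, where $\mathrm{Exp}[X]=\sum_{m\ge0}h_m[X]$ and $\langle z^n\rangle$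 takes the coefficient of $z^n$. For $k\ge 1$ let $\partial_-^{(k)}:\mathscr{P}(k)^+\to\mathscr{P}(k-1)^+$ be the $\mathscr{P}_{k-1}^+$-linear map with $$\partial_-^{(k)}\big(x_k^nF[x_{k+1}+x_{k+2}+\cdots]\big)=\mathscr{B}_n(F)[x_k+x_{k+1}+\cdots]\qquad(n\ge 0,\ F\in\Lambda),$$ and for $g\in\mathscr{P}(n)^+$ with $n\ge\ell$ let $\widetilde{\sigma}_\ell(g)=\partial_-^{(\ell+1)}\cdots\partial_-^{(n)}(g)\in\mathscr{P}(\ell)^+$. **Proposition.** For every $\ell\ge 0$ the operator $\widetilde{\sigma}_\ell:\mathscr{P}_{as}^+\to\mathscr{P}(\ell)^+$ is well defined (independent of the choice of $n$), the sequence of operators $(\epsilon_\ell^{(n)})_{n>\ell}$ converges to a unique limit operator $\epsilon_\ell$ on $\mathscr{P}_{as}^+$, and $$\epsilon_\ell=\widetilde{\sigma}_\ell .$$ Moreover, for every partition $\lambda=(\lambda_1\ge\dots\ge\lambda_r\ge1)$ the function $\mathcal{P}_\lambda=\mathscr{B}_{\lambda_1}\cdots\mathscr{B}_{\lambda_r}(1)$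 equals Macdonald's dual Hall–Littlewood function $Q_\lambda[X;t]$; that is, for every $n\ge r$, $$\mathcal{P}_\lambda[x_1+\cdots+x_n]=Q_\lambda(x_1,\dots,x_n;t)=\frac{b_\lambda(t)}{v_{\lambda}(t)}\sum_{w\in\mathfrak{S}_n}w\Big(x_1^{\lambda_1}\cdots x_r^{\lambda_r}\prod_{1\le i<j\le n}\frac{x_i-tx_j}{x_i-x_j}\Big),$$ where $v_\lambda(t)=\prod_{i\ge 0}[m_i]_t!$ and $b_\lambda(t)=\prod_{i\ge1}\prod_{j=1}^{m_i}(1-t^j)$, with $m_i$ the number of parts of $\lambda$ equal to $i$ for $i\ge1$ and $m_0=n-r$. -/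

import Mathlib

open scoped WithZero

noncomputable section

namespace StableLimit

/-! ### Scalars -/

/-- The field `ℚ(q,t)`, realized as `ℚ(q)(t)`. -/
abbrev K : Type := RatFunc (RatFunc ℚ)

/-- The parameter `t`. -/
def t : K := RatFunc.X

/-- The sequence `a` of scalars converges to `L` in the `t`-adic topology of `ℚ(q,t)`. -/
def TAdicTendsto (a : ℕ → K) (L : K) : Prop :=
  ∀ γ : (ℤᵐ⁰)ˣ, ∃ M : ℕ, ∀ m ≥ M,
    (Polynomial.idealX (RatFunc ℚ)).valuation K (a m - L) < γ

/-- The `t`-factorial `[m]_t! = ∏_{i=1}^m (1 - t^i)/(1 - t)`. -/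
def tFactorial (m : ℕ) : K := ∏ i ∈ Finset.Icc 1 m, (1 - t ^ i) / (1 - t)

/-! ### Polynomials and their inverse limit -/

/-- The polynomial ring `𝒫_n⁺ = ℚ(q,t)[x_1, …, x_n]`; the variable `x_{i+1}` is `X i`. -/
abbrev Pol (n : ℕ) : Type := MvPolynomial (Fin n) K

/-- The map `π_n : 𝒫_{n+1}⁺ → 𝒫_n⁺` which sends `x_{n+1}` to `0`. -/
def trunc (n : ℕ) : Pol (n + 1) →ₐ[K] Pol n :=
  MvPolynomial.aeval (Fin.lastCases 0 MvPolynomial.X)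

/-- The inverse limit `𝒫_∞⁺` of the rings `𝒫_n⁺`: an element is a compatible family of
polynomials, and the extended map `π_n : 𝒫_∞⁺ → 𝒫_n⁺` is evaluation of the family at `n`. -/
def PInf : Subalgebra K (∀ n, Pol n) where
  carrier := {f | ∀ n, trunc n (f (n + 1)) = f n}
  mul_mem' := by
    intro a b ha hb n
    simp only [Set.mem_ofPred_eq] at ha hb
    simp [ha n, hb n]
  add_mem' := by
    intro a b ha hb n
    simp only [Set.mem_ofPred_eq] at ha hb
    simp [ha n, hb n]
  algebraMap_mem' := by
    intro r n
    simp

/-- The variable `x_{i+1}` as an element of `𝒫_∞⁺`. -/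
def xInf (i : ℕ) : PInf :=
  ⟨fun n => if h : i < n then MvPolynomial.X ⟨i, h⟩ else 0, by
    intro n
    rcases lt_trichotomy i n with h | h | h
    · have e : (⟨i, h.trans n.lt_succ_self⟩ : Fin (n + 1)) = Fin.castSucc ⟨i, h⟩ := rfl
      simp only [h, h.trans n.lt_succ_self, dif_pos, e, trunc, MvPolynomial.aeval_X,
        Fin.lastCases_castSucc]
    · subst h
      have e : (⟨i, i.lt_succ_self⟩ : Fin (i + 1)) = Fin.last i := rfl
      simp only [i.lt_succ_self, dif_pos, e, trunc, MvPolynomial.aeval_X, Fin.lastCases_last]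
      simp
    · simp [show ¬ i < n by omega, show ¬ i < n + 1 by omega]⟩

/-- The power sum `p_r[x_{k+1} + x_{k+2} + ⋯]` as an element of `𝒫_∞⁺`. -/
def pInf (k : ℕ) (r : ℕ+) : PInf :=
  ⟨fun n => ∑ j : Fin n, if k ≤ j then MvPolynomial.X j ^ (r : ℕ) else 0, by
    intro n
    simp only [Fin.sum_univ_castSucc, map_add]
    have : trunc n (if k ≤ (Fin.last n : ℕ) then MvPolynomial.X (Fin.last n) ^ (r : ℕ)
        else 0) = 0 := by
      split_ifs <;> simp [trunc, r.pos.ne']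
    rw [this, add_zero, map_sum]
    refine Finset.sum_congr rfl fun j _ => ?_
    split_ifs <;> simp_all [trunc]⟩

/-! ### Symmetric functions -/

/-- The ring of symmetric functions `Λ = ℚ(q,t)[p_1, p_2, …]`; the power sum `p_r` is `X r`. -/
abbrev SymFun : Type := MvPolynomial ℕ+ K

/-- The plethystic substitution `F ↦ F[x_{k+1} + x_{k+2} + ⋯]`. -/
def inAlphabet (k : ℕ) : SymFun →ₐ[K] PInf := MvPolynomial.aeval (pInf k)

/-- The complete homogeneous symmetric functions `h_n`, through `n h_n = ∑_{r=1}^n p_r h_{n-r}`. -/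
def hSym : ℕ → SymFun
  | 0 => 1
  | n + 1 => MvPolynomial.C ((n + 1 : K)⁻¹) *
      ∑ r : Fin (n + 1), (MvPolynomial.X (Nat.succPNat r) : SymFun) * hSym (n - r)

section Complete

open MvPolynomial

theorem coeff_hsymm {N n : ℕ} (m : Fin N →₀ ℕ) :
    coeff m (hsymm (Fin N) K n) = if m.degree = n then 1 else 0 := by
  classical
  have h : ∀ s : Sym (Fin N) n, (s.1.map (X : Fin N → MvPolynomial (Fin N) K)).prod =
      monomial (Multiset.toFinsupp s.1) 1 := by
    intro s
    generalize s.1 = u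
    induction u using Multiset.induction_on with
    | empty => simp
    | cons a u ih =>
      rw [Multiset.map_cons, Multiset.prod_cons, ih, ← Multiset.singleton_add, map_add,
        Multiset.toFinsupp_singleton, X, monomial_mul, one_mul]
  simp only [hsymm, h, coeff_sum, coeff_monomial]
  split_ifs with hm
  · have hc : (Finsupp.toMultiset m).card = n := by
      rw [Finsupp.card_toMultiset, ← hm]; rfl
    refine (Finset.sum_eq_single (ι := Sym (Fin N) n) (Subtype.mk (Finsupp.toMultiset m) hc) ?_ ?_).trans ?_
    · intro b _ hb
      refine if_neg ?_
      rintro rfl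
      exact hb (Subtype.ext (Multiset.toFinsupp_toMultiset _).symm)
    · exact fun h => absurd (Finset.mem_univ _) h
    · exact if_pos (Finsupp.toMultiset_toFinsupp m)
  · refine Finset.sum_eq_zero fun s _ => if_neg ?_
    rintro rfl
    apply hm
    refine Eq.trans ?_ s.2
    generalize s.1 = u
    conv_rhs => rw [← Multiset.toFinsupp_toMultiset u, Finsupp.card_toMultiset]
    rfl

theorem newton_hsymm {N n : ℕ} :
    ∑ r ∈ Finset.range (n + 1), psum (Fin N) K (r + 1) * hsymm (Fin N) K (n - r) =
      ((n + 1 : ℕ) : MvPolynomial (Fin N) K) * hsymm (Fin N) K (n + 1) := by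
  classical
  ext m
  rw [← map_natCast (C : K →+* MvPolynomial (Fin N) K), coeff_C_mul, coeff_hsymm]
  simp only [psum, Finset.sum_mul, coeff_sum]
  have h : ∀ r ∈ Finset.range (n + 1), ∀ j : Fin N,
      coeff m (X j ^ (r + 1) * hsymm (Fin N) K (n - r)) =
        if m.degree = n + 1 then (if r < m j then 1 else 0) else 0 := by
    intro r hr j
    have hr' := Finset.mem_range.1 hr
    rw [X_pow_eq_monomial, coeff_monomial_mul', one_mul, coeff_hsymm]
    by_cases hj : r < m j
    · have hle : Finsupp.single j (r + 1) ≤ m := by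
        rw [Finsupp.single_le_iff]; exact hj
      have hd : (m - Finsupp.single j (r + 1)).degree + (r + 1) = m.degree := by
        conv_rhs => rw [← tsub_add_cancel_of_le hle, map_add, Finsupp.degree_single]
      rw [if_pos hle, if_pos hj]
      exact if_congr (by omega) rfl rfl
    · rw [if_neg, if_neg hj, ite_self]
      rw [Finsupp.single_le_iff]; exact hj
  rw [Finset.sum_congr rfl fun r hr => Finset.sum_congr rfl fun j _ => h r hr j]
  split_ifs with hm
  · have hc : ((n + 1 : ℕ) : K) = ∑ j, (m j : K) := by
      rw [← hm, Finsupp.degree_eq_sum, Nat.cast_sum]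
    rw [Finset.sum_comm, mul_one, hc]
    refine Finset.sum_congr rfl fun j _ => ?_
    have : m j ≤ n + 1 := hm ▸ Finsupp.le_degree j m
    have hf : {r ∈ Finset.range (n + 1) | r < m j} = Finset.range (m j) := by
      ext r
      simp only [Finset.mem_filter, Finset.mem_range]
      omega
    rw [Finset.sum_boole, hf, Finset.card_range]
  · simp

/-- The element `h_n` of `Λ` is the complete homogeneous symmetric function: in `N` variables it is
the sum of all monomials of degree `n`. -/
theorem inAlphabet_hSym (n N : ℕ) : (inAlphabet 0 (hSym n)).1 N = hsymm (Fin N) K n := by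
  let ev : PInf →ₐ[K] Pol N := (Pi.evalAlgHom K Pol N).comp PInf.val
  have hev : ∀ F : PInf, F.1 N = ev F := fun _ => rfl
  rw [hev]
  induction n using Nat.strong_induction_on with
  | _ n ih =>
    cases n with
    | zero => simp [hSym]
    | succ n =>
      have hp : ∀ r : ℕ+, ev (inAlphabet 0 (X r)) = psum (Fin N) K r := by
        intro r
        simp [inAlphabet, ← hev, pInf, psum]
      have hn : ((n + 1 : ℕ) : K) ≠ 0 := by exact_mod_cast n.succ_ne_zero
      have hC : ev (inAlphabet 0 (C ((n + 1 : K)⁻¹))) = C ((n + 1 : K)⁻¹) :=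
        (ev.comp (inAlphabet 0)).commutes _
      rw [hSym]
      simp only [map_mul, map_sum, hp, hC, Nat.succPNat_coe, Nat.succ_eq_add_one]
      rw [Finset.sum_congr rfl fun r _ => by rw [ih (n - r) (by omega)],
        Fin.sum_univ_eq_sum_range
          (fun r => psum (Fin N) K (r + 1) * hsymm (Fin N) K (n - r)) (n + 1),
        newton_hsymm, ← mul_assoc, ← map_natCast (C : K →+* Pol N), ← map_mul]
      rw [show ((n : K) + 1)⁻¹ * ((n + 1 : ℕ) : K) = 1 by
        rw [← Nat.cast_succ]; exact inv_mul_cancel₀ hn]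
      simp

end Complete

/-- The plethystic substitution `F ↦ F[(1-t)X]`, that is `p_r ↦ (1 - t^r) p_r`. -/
def plethOneSubT : SymFun →ₐ[K] SymFun :=
  MvPolynomial.aeval fun r : ℕ+ => MvPolynomial.C (1 - t ^ (r : ℕ)) * MvPolynomial.X r

/-- The plethystic substitution `F ↦ F[X - z⁻¹]`, that is `p_r ↦ p_r - z^{-r}`; the result is a
polynomial in `w = z⁻¹` with coefficients in `Λ`. -/
def shiftAlphabet : SymFun →ₐ[K] Polynomial SymFun :=
  MvPolynomial.aeval fun r : ℕ+ => Polynomial.C (MvPolynomial.X r) - Polynomial.X ^ (r : ℕ)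

/-- The Jing vertex operator `B_n(F) = ⟨z^n⟩ F[X - z⁻¹] Exp[(1-t)zX]`. If
`F[X - z⁻¹] = ∑_j c_j z^{-j}`, then, as `Exp[(1-t)zX] = ∑_m h_m[(1-t)X] z^m`, the coefficient of
`z^n` is `∑_j c_j h_{n+j}[(1-t)X]`. -/
def jing (n : ℕ) (F : SymFun) : SymFun :=
  (shiftAlphabet F).sum fun j c => c * plethOneSubT (hSym (n + j))

/-- The Hall–Littlewood symmetric function `𝒫_λ = B_{λ_1} ⋯ B_{λ_r}(1)`. -/
def hallLittlewood (lam : List ℕ) : SymFun := lam.foldr jing 1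

/-! ### Almost symmetric functions -/

/-- The tensor product `ℚ(q,t)[x_1, …, x_k] ⊗ Λ`, as polynomials in `x_1, …, x_k` over `Λ`. -/
abbrev Tens (k : ℕ) : Type := MvPolynomial (Fin k) SymFun

/-- The map `x^μ ⊗ F ↦ x^μ F[x_{k+1} + x_{k+2} + ⋯]` into `𝒫_∞⁺`. -/
def realize (k : ℕ) : Tens k →ₐ[K] PInf :=
  MvPolynomial.aevalTower (inAlphabet k) (fun i => xInf i)

/-- `𝒫(k)⁺ = ℚ(q,t)[x_1, …, x_k] ⊗ Λ[x_{k+1} + x_{k+2} + ⋯]` inside `𝒫_∞⁺`. -/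
def PK (k : ℕ) : Subalgebra K PInf := (realize k).range

/-- The set of almost symmetric functions `𝒫_as⁺ = ⋃_k 𝒫(k)⁺`. -/
def Pas : Set PInf := {f | ∃ k, f ∈ PK k}

section Injectivity

open MvPolynomial

/-- The power sums `p_1, …, p_N` in `N` variables are algebraically independent. -/
theorem psum_injective (N : ℕ) :
    Function.Injective (aeval (fun i : Fin N => psum (Fin N) K (i + 1)) : Pol N →ₐ[K] Pol N) := by
  set e := esymmAlgEquiv (R := K) (n := N) (Fin N) (Fintype.card_fin N)
  let P : Fin N → symmetricSubalgebra (Fin N) K :=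
    fun i => ⟨psum (Fin N) K (i + 1), psum_isSymmetric _ _ _⟩
  let x : Fin N → Pol N := fun i => e.symm (P i)
  have hes : ∀ k, k ≤ N → (⟨esymm (Fin N) K k, esymm_isSymmetric _ _ _⟩ :
      symmetricSubalgebra (Fin N) K) ∈ Algebra.adjoin K (Set.range P) := by
    intro k
    induction k using Nat.strong_induction_on with
    | _ k ih =>
      intro hk
      rcases Nat.eq_zero_or_pos k with rfl | hk0
      · convert Subalgebra.one_mem _ using 1
        exact Subtype.ext (by simp)
      have hk' : (k : K) ≠ 0 := by exact_mod_cast hk0.ne'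
      have key : (⟨esymm (Fin N) K k, esymm_isSymmetric _ _ _⟩ :
          symmetricSubalgebra (Fin N) K) = (k : K)⁻¹ • ((-1) ^ (k + 1) *
          ∑ a ∈ Finset.HasAntidiagonal.antidiagonal k with a.1 < k, (-1) ^ a.1 *
            ⟨esymm (Fin N) K a.1, esymm_isSymmetric _ _ _⟩ *
            ⟨psum (Fin N) K a.2, psum_isSymmetric _ _ _⟩) := by
        apply Subtype.ext
        have := mul_esymm_eq_sum (Fin N) K k
        simp only [SetLike.val_smul, MulMemClass.coe_mul, SubmonoidClass.coe_pow,
          AddSubmonoidClass.coe_finsetSum, NegMemClass.coe_neg, OneMemClass.coe_one]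
        rw [← this, eq_inv_smul_iff₀ hk', Algebra.smul_def]
        simp
      rw [key]
      refine Subalgebra.smul_mem _ (Subalgebra.mul_mem _ (Subalgebra.pow_mem _
        (Subalgebra.neg_mem _ (Subalgebra.one_mem _)) _) (Subalgebra.sum_mem _ ?_)) _
      intro a ha
      simp only [Finset.mem_filter, Finset.HasAntidiagonal.mem_antidiagonal] at ha
      refine Subalgebra.mul_mem _ (Subalgebra.mul_mem _ (Subalgebra.pow_mem _
        (Subalgebra.neg_mem _ (Subalgebra.one_mem _)) _) (ih _ ha.2 (by omega))) ?_
      apply Algebra.subset_adjoin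
      refine ⟨⟨a.2 - 1, by omega⟩, Subtype.ext ?_⟩
      simp only [P]
      congr 1
      omega
  have htop : Algebra.adjoin K (Set.range x) = ⊤ := by
    rw [eq_top_iff, ← adjoin_range_X]
    refine Algebra.adjoin_le ?_
    rintro _ ⟨i, rfl⟩
    have h1 := hes (i + 1) i.2
    have h2 : e.symm ⟨esymm (Fin N) K (i + 1), esymm_isSymmetric _ _ _⟩ = X i :=
      esymmAlgEquiv_symm_apply K (Fintype.card_fin N) i
    have h3 : e.symm ⟨esymm (Fin N) K (i + 1), esymm_isSymmetric _ _ _⟩ ∈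
        (Algebra.adjoin K (Set.range P)).map e.symm.toAlgHom := ⟨_, h1, rfl⟩
    rw [h2, AlgHom.map_adjoin, ← Set.range_comp] at h3
    exact h3
  have : Algebra.IsAlgebraic (Algebra.adjoin K (Set.range x)) (Pol N) := by
    rw [htop]
    exact ⟨fun a => isAlgebraic_algebraMap (⟨a, trivial⟩ : (⊤ : Subalgebra K (Pol N)))⟩
  have hx : AlgebraicIndependent K x :=
    (Algebra.IsAlgebraic.isTranscendenceBasis_of_lift_le_trdeg_of_finite K x (by
      rw [MvPolynomial.trdeg_of_isDomain]; simp)).1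
  have hcomp : (aeval (fun i : Fin N => psum (Fin N) K (i + 1)) : Pol N →ₐ[K] Pol N) =
      ((symmetricSubalgebra (Fin N) K).val.comp e.toAlgHom).comp (aeval x) := by
    ext i
    simp [x, P]
  rw [hcomp]
  exact (Subtype.val_injective.comp e.injective).comp hx

/-- A symmetric function that vanishes in every finite number of variables is zero. -/
theorem symFun_eq_zero (G : SymFun)
    (hG : ∀ N, aeval (fun r : ℕ+ => psum (Fin N) K r) G = 0) : G = 0 := by
  obtain ⟨N, hN⟩ : ∃ N : ℕ, ∀ r ∈ G.vars, (r : ℕ) ≤ N :=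
    ⟨G.vars.sup fun r => (r : ℕ), fun r hr => Finset.le_sup (f := fun r : ℕ+ => (r : ℕ)) hr⟩
  let f : Fin N → ℕ+ := fun i => ⟨i + 1, i.val.succ_pos⟩
  have hf : Function.Injective f := by
    intro a b h
    have := congrArg PNat.val h
    simp only [f, PNat.mk_coe] at this
    exact Fin.ext (by omega)
  obtain ⟨G', rfl⟩ := exists_rename_eq_of_vars_subset_range G f hf (by
    intro r hr
    have := hN r hr
    have := r.pos
    exact ⟨⟨r - 1, by omega⟩, PNat.eq (by simp only [f, PNat.mk_coe]; omega)⟩)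
  have h := hG N
  rw [aeval_rename] at h
  have := psum_injective N (a₁ := G') (a₂ := 0) (by rw [map_zero]; exact h)
  rw [this, map_zero]

theorem realize_injective (k : ℕ) : Function.Injective (realize k) := by
  rw [injective_iff_map_eq_zero]
  intro F hF
  ext1 m
  refine symFun_eq_zero _ fun N => ?_
  let φ : SymFun →ₐ[K] Pol N := aeval (fun r : ℕ+ => psum (Fin N) K r)
  let ev : PInf →ₐ[K] Pol (k + N) := (Pi.evalAlgHom K Pol (k + N)).comp PInf.val
  have hcomp : ev.comp (realize k) = (((rename finSumFinEquiv).comp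
      (sumAlgEquiv K (Fin k) (Fin N)).symm.toAlgHom)).comp (mapAlgHom φ) := by
    ext r
    · have h1 : (pInf k r).1 (k + N) =
          ∑ x : Fin N, (X (Fin.natAdd k x) : Pol (k + N)) ^ (r : ℕ) := by
        simp only [pInf, Fin.sum_univ_add]
        simp [fun x : Fin k => show ¬ k ≤ (x : ℕ) by omega]
      simp [ev, φ, realize, inAlphabet, h1, psum]
    · simp [ev, realize, xInf, show (r : ℕ) < k + N by omega, Fin.castAdd, Fin.castLE]
  have h0 : mapAlgHom φ F = 0 := by
    have h : ev.comp (realize k) F = 0 := by simp [hF]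
    rw [hcomp] at h
    rw [AlgHom.comp_apply, AlgHom.comp_apply] at h
    have h' := rename_injective _ finSumFinEquiv.injective (h.trans (map_zero _).symm)
    exact (sumAlgEquiv K (Fin k) (Fin N)).symm.injective (h'.trans (map_zero _).symm)
  have := congrArg (coeff m) h0
  rw [coeff_zero] at this
  exact (coeff_map _ _ _).symm.trans this

end Injectivity

/-- The identification of `𝒫(k)⁺` with `ℚ(q,t)[x_1, …, x_k] ⊗ Λ`. -/
def equivTens (k : ℕ) : PK k ≃ₐ[K] Tens k :=
  (AlgEquiv.ofInjective (realize k) (realize_injective k)).symm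

theorem PK_le_succ (k : ℕ) : PK k ≤ PK (k + 1) := by
  have hx : ∀ i : Fin (k + 1), xInf i ∈ PK (k + 1) := fun i =>
    ⟨MvPolynomial.X i, by simp [realize]⟩
  have hp : ∀ r, pInf (k + 1) r ∈ PK (k + 1) := fun r =>
    ⟨MvPolynomial.C (MvPolynomial.X r), by simp [realize, inAlphabet]⟩
  have hpk : ∀ r, pInf k r = xInf k ^ (r : ℕ) + pInf (k + 1) r := by
    intro r
    apply Subtype.ext
    funext n
    have h1 : ((xInf k ^ (r : ℕ) + pInf (k + 1) r : PInf) : ∀ n, Pol n) n =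
        (xInf k).1 n ^ (r : ℕ) + (pInf (k + 1) r).1 n := rfl
    rw [h1]
    simp only [pInf, xInf]
    by_cases h : k < n
    · rw [dif_pos h, ← Finset.add_sum_erase _ _ (Finset.mem_univ (⟨k, h⟩ : Fin n)),
        ← Finset.add_sum_erase (Finset.univ : Finset (Fin n))
          (fun j => if k + 1 ≤ (j : ℕ) then _ else _) (Finset.mem_univ (⟨k, h⟩ : Fin n))]
      simp only [le_refl, if_true, Nat.not_succ_le_self, if_false, zero_add]
      congr 1
      refine Finset.sum_congr rfl fun j hj => ?_
      have : (j : ℕ) ≠ k := fun e => (Finset.mem_erase.1 hj).1 (Fin.ext e)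
      simp only [show k ≤ (j : ℕ) ↔ k + 1 ≤ (j : ℕ) by omega]
    · rw [dif_neg h, zero_pow r.pos.ne', zero_add]
      refine Finset.sum_congr rfl fun j _ => ?_
      rw [if_neg (by omega), if_neg (by omega)]
  have hΛ : ∀ G : SymFun, inAlphabet k G ∈ PK (k + 1) := by
    intro G
    induction G using MvPolynomial.induction_on with
    | C a => simp [inAlphabet]
    | add p q hp hq => rw [map_add]; exact add_mem hp hq
    | mul_X p r hp' =>
      rw [map_mul]
      refine mul_mem hp' ?_
      rw [show inAlphabet k (MvPolynomial.X r) = pInf k r by simp [inAlphabet], hpk]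
      exact add_mem (pow_mem (hx (Fin.last k)) _) (hp r)
  rintro _ ⟨F, rfl⟩
  change realize k F ∈ PK (k + 1)
  induction F using MvPolynomial.induction_on with
  | C G => simpa [realize] using hΛ G
  | add p q hp hq => rw [map_add]; exact add_mem hp hq
  | mul_X p i hp' =>
    rw [map_mul]
    refine mul_mem hp' ?_
    simpa [realize] using hx i.castSucc

/-! ### The lowering operators and stable symmetrization -/

/-- The lowering operator on tensors: it is linear over `ℚ(q,t)[x_1, …, x_k]` and sends
`x_{k+1}^n ⊗ F` to `B_n(F)`. -/
def lowerTens (k : ℕ) (f : Tens (k + 1)) : Tens k :=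
  ∑ m ∈ f.support, MvPolynomial.monomial
    (Finsupp.equivFunOnFinite.symm fun i : Fin k => m i.castSucc)
    (jing (m (Fin.last k)) (f.coeff m))

/-- The lowering operator `∂_-^{(k+1)} : 𝒫(k+1)⁺ → 𝒫(k)⁺`: the `ℚ(q,t)[x_1, …, x_k]`-linear map
with `x_{k+1}^n F[x_{k+2} + x_{k+3} + ⋯] ↦ B_n(F)[x_{k+1} + x_{k+2} + ⋯]`. -/
def lower (k : ℕ) (f : PK (k + 1)) : PK k :=
  (equivTens k).symm (lowerTens k (equivTens (k + 1) f))

/-- The composite `∂_-^{(l+1)} ⋯ ∂_-^{(l+d)} : 𝒫(l+d)⁺ → 𝒫(l)⁺`. -/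
def lowerTo (l : ℕ) : (d : ℕ) → PK (l + d) → PK l
  | 0, f => f
  | d + 1, f => lowerTo l d (lower (l + d) f)

theorem exists_mem_PK (l : ℕ) (f : Pas) : ∃ d, (f : PInf) ∈ PK (l + d) := by
  obtain ⟨k, hk⟩ := f.2
  exact ⟨k, monotone_nat_of_le_succ PK_le_succ (Nat.le_add_left k l) hk⟩

open Classical in
/-- The partial stable symmetrization operator `σ̃_l : 𝒫_as⁺ → 𝒫(l)⁺`, that is
`∂_-^{(l+1)} ⋯ ∂_-^{(n)} f` for the least `n ≥ l` with `f ∈ 𝒫(n)⁺`. -/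
def stableSymm (l : ℕ) (f : Pas) : PK l :=
  lowerTo l (Nat.find (exists_mem_PK l f)) ⟨f, Nat.find_spec (exists_mem_PK l f)⟩

/-! ### Demazure–Lusztig operators and the partial trivial idempotents -/

theorem sub_dvd_sub_swap {n : ℕ} (i j : Fin n) (f : Pol n) :
    (MvPolynomial.X i - MvPolynomial.X j : Pol n) ∣
      f - MvPolynomial.rename (Equiv.swap i j) f := by
  rw [← Ideal.mem_span_singleton, ← Ideal.Quotient.mk_eq_mk_iff_sub_mem]
  set I : Ideal (Pol n) := Ideal.span {MvPolynomial.X i - MvPolynomial.X j}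
  have hij : Ideal.Quotient.mk I (MvPolynomial.X i) = Ideal.Quotient.mk I (MvPolynomial.X j) := by
    rw [Ideal.Quotient.mk_eq_mk_iff_sub_mem]
    exact Ideal.subset_span rfl
  have : Ideal.Quotient.mkₐ K I = (Ideal.Quotient.mkₐ K I).comp
      (MvPolynomial.rename (Equiv.swap i j)) := by
    ext m
    simp only [AlgHom.comp_apply, MvPolynomial.rename_X, Ideal.Quotient.mkₐ_eq_mk]
    rcases eq_or_ne m i with rfl | hi
    · rw [Equiv.swap_apply_left, hij]
    rcases eq_or_ne m j with rfl | hj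
    · rw [Equiv.swap_apply_right, hij]
    · rw [Equiv.swap_apply_of_ne_of_ne hi hj]
  exact congrArg (fun φ => φ f) this

/-- The polynomial `(f - s f)/(x_i - x_j)` where `s` swaps the variables `x_i` and `x_j`
(used for `i ≠ j`, when it is unique). -/
def divDiff {n : ℕ} (i j : Fin n) (f : Pol n) : Pol n := (sub_dvd_sub_swap i j f).choose

/-- The indices of the simple transpositions of `𝔖_n`: the index `i` (with `i + 1 < n`) stands for
the transposition of the `0`-based positions `i` and `i + 1`. -/
abbrev SimpleIndex (n : ℕ) : Type := {i : ℕ // i + 1 < n}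

/-- The position `i` of the index `i`. -/
def SimpleIndex.lo {n : ℕ} (i : SimpleIndex n) : Fin n := ⟨i.1, by have := i.2; omega⟩

/-- The position `i + 1` of the index `i`. -/
def SimpleIndex.hi {n : ℕ} (i : SimpleIndex n) : Fin n := ⟨i.1 + 1, i.2⟩

/-- The simple transposition `s_i`. -/
def simpleRefl {n : ℕ} (i : SimpleIndex n) : Equiv.Perm (Fin n) := Equiv.swap i.lo i.hi

/-- The Demazure–Lusztig operator `T_i f = s_i f + (1-t) x_i (f - s_i f)/(x_i - x_{i+1})`. -/
def demazureLusztig {n : ℕ} (i : SimpleIndex n) (f : Pol n) : Pol n :=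
  MvPolynomial.rename (simpleRefl i) f +
    MvPolynomial.C (1 - t) * MvPolynomial.X i.lo * divDiff i.lo i.hi f

/-- `w` is a reduced word for the permutation `σ`: `σ = s_{i_1} ⋯ s_{i_r}` with `r` minimal. -/
def IsReducedWord {n : ℕ} (σ : Equiv.Perm (Fin n)) (w : List (SimpleIndex n)) : Prop :=
  (w.map simpleRefl).prod = σ ∧
    ∀ w' : List (SimpleIndex n), (w'.map simpleRefl).prod = σ → w.length ≤ w'.length

theorem exists_reducedWord {n : ℕ} (σ : Equiv.Perm (Fin n)) : ∃ w, IsReducedWord σ w := by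
  have hne : {w : List (SimpleIndex n) | (w.map simpleRefl).prod = σ}.Nonempty := by
    cases n with
    | zero => exact ⟨[], Subsingleton.elim _ _⟩
    | succ n =>
      have h : σ ∈ Submonoid.closure
          (Set.range fun i : Fin n => Equiv.swap i.castSucc i.succ) := by
        rw [Equiv.Perm.mclosure_swap_castSucc_succ]; trivial
      induction h using Submonoid.closure_induction with
      | mem x hx =>
        obtain ⟨i, rfl⟩ := hx
        exact ⟨[⟨i, by omega⟩], by simp [simpleRefl]; rfl⟩
      | one => exact ⟨[], rfl⟩
      | mul x y _ _ hx hy =>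
        obtain ⟨a, ha⟩ := hx
        obtain ⟨b, hb⟩ := hy
        exact ⟨a ++ b, by
          change (a.map simpleRefl).prod = x at ha
          change (b.map simpleRefl).prod = y at hb
          change ((a ++ b).map simpleRefl).prod = x * y
          rw [List.map_append, List.prod_append, ha, hb]⟩
  obtain ⟨w, hw, hmin⟩ := WellFounded.has_min (measure List.length).wf _ hne
  exact ⟨w, hw, fun w' hw' => not_lt.1 (hmin w' hw')⟩

/-- A reduced word for `σ`. -/
def reducedWord {n : ℕ} (σ : Equiv.Perm (Fin n)) : List (SimpleIndex n) :=
  (exists_reducedWord σ).choose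

/-- The Coxeter length `ℓ(σ)`. -/
def len {n : ℕ} (σ : Equiv.Perm (Fin n)) : ℕ := (reducedWord σ).length

/-- The operator `T_σ = T_{i_1} ⋯ T_{i_r}` for a reduced word `σ = s_{i_1} ⋯ s_{i_r}`. -/
def heckeT {n : ℕ} (σ : Equiv.Perm (Fin n)) (f : Pol n) : Pol n :=
  (reducedWord σ).foldr demazureLusztig f

/-- The Young subgroup `𝔖_{(1^k, n-k)}` of `𝔖_n`, the permutations that fix `1, …, k`. -/
def young (k n : ℕ) : Finset (Equiv.Perm (Fin n)) := {σ | ∀ i : Fin n, (i : ℕ) < k → σ i = i}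

/-- The partial trivial Hecke idempotent `ε_k^{(n)} : 𝒫_n⁺ → 𝒫_n⁺` (for `k < n`), that is
`ε_k^{(n)}(f) = ([n-k]_t!)⁻¹ ∑_{σ ∈ 𝔖_{(1^k,n-k)}} t^{binom(n-k,2) - ℓ(σ)} T_σ(f)`. -/
def partialIdempotent (k n : ℕ) (f : Pol n) : Pol n :=
  (tFactorial (n - k))⁻¹ •
    ∑ σ ∈ young k n, t ^ (((n - k).choose 2 : ℤ) - (len σ : ℤ)) • heckeT σ f

/-! ### Convergence -/

/-- The sequence `(f_m)_{m ≥ m₀}` with `f_m ∈ 𝒫_m⁺` converges with limit `F`: there are finitely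
many `g_i ∈ 𝒫_as⁺`, an `h ∈ 𝒫_∞⁺` and scalar sequences `a_i(m)` with `t`-adic limits `c_i` such
that `f_m = π_m(h) + ∑_i a_i(m) π_m(g_i)` for all `m ≥ m₀` and `F = h + ∑_i c_i g_i`. -/
def HasLimit (m₀ : ℕ) (f : ∀ m, Pol m) (F : PInf) : Prop :=
  ∃ (N : ℕ) (h : PInf) (g : Fin N → PInf) (a : Fin N → ℕ → K) (c : Fin N → K),
    (∀ i, g i ∈ Pas) ∧ (∀ i, TAdicTendsto (a i) (c i)) ∧
    (∀ m ≥ m₀, f m = h.1 m + ∑ i, a i m • (g i).1 m) ∧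
    F = h + ∑ i, c i • g i

/-- The sequence of operators `A_m : 𝒫_m⁺ → 𝒫_m⁺`, `m ≥ m₀`, converges to the operator
`A : 𝒫_as⁺ → 𝒫_as⁺`: for every `f ∈ 𝒫_as⁺` the sequence `A_m(π_m(f))` converges to `A(f)`. -/
def HasLimitOperator (m₀ : ℕ) (A' : ∀ m, Pol m → Pol m) (A : Pas → Pas) : Prop :=
  ∀ f : Pas, HasLimit m₀ (fun m => A' m (f.1.1 m)) (A f)

/-! ### Macdonald's dual Hall–Littlewood polynomials -/

/-- The Hall–Littlewood polynomial `P_λ(x_1, …, x_n; t)`, where `λ` has at most `n` parts: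
`P_λ = v_λ(t)⁻¹ ∑_{w ∈ 𝔖_n} w (x^λ ∏_{i<j} (x_i - t x_j)/(x_i - x_j))`, in which
`v_λ(t) = ∏_{i ≥ 0} [m_i]_t!` for the multiplicities `m_i` of `λ` (so `m_0 = n - ℓ(λ)`). -/
def macdonaldP (lam : List ℕ) (n : ℕ) : FractionRing (Pol n) :=
  let x : Fin n → FractionRing (Pol n) := fun i => algebraMap (Pol n) _ (MvPolynomial.X i)
  let τ : FractionRing (Pol n) := algebraMap (Pol n) _ (MvPolynomial.C t)
  (algebraMap (Pol n) (FractionRing (Pol n)) (MvPolynomial.C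
    (tFactorial (n - lam.length) * ∏ i ∈ lam.toFinset, tFactorial (lam.count i))))⁻¹ *
  ∑ w : Equiv.Perm (Fin n), (∏ i : Fin n, x (w i) ^ lam.getD i 0) *
    ∏ i : Fin n, ∏ j ∈ Finset.Ioi i, (x (w i) - τ * x (w j)) / (x (w i) - x (w j))

/-- The dual Hall–Littlewood polynomial `Q_λ(x_1, …, x_n; t) = b_λ(t) P_λ(x_1, …, x_n; t)`, where
`b_λ(t) = ∏_{i ≥ 1} ∏_{j=1}^{m_i} (1 - t^j)`. -/
def macdonaldQ (lam : List ℕ) (n : ℕ) : FractionRing (Pol n) :=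
  algebraMap (Pol n) (FractionRing (Pol n)) (MvPolynomial.C
    (∏ i ∈ lam.toFinset, ∏ j ∈ Finset.Icc 1 (lam.count i), (1 - t ^ j))) * macdonaldP lam n

end StableLimit

end

open StableLimit

/-! In finitely many variables every operator here is a symmetrization. With positions counted from
0, let Sym_l(F) be the sum of w(F ∏ (x_i - t x_j)/(x_i - x_j)), the product over l ≤ i < j and the
sum over the permutations w fixing the first l positions. Two facts identify the idempotent with
Sym_l / [n-l]_t!: Sym_l(T_i F) = Sym_l(F), and ∑ t^(N-ℓ(σ)) T_σ(f) is already invariant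
(`toRat_partialIdempotent`). Since T_σ is defined by a chosen reduced word, Matsumoto's theorem is
needed to know T_{s_i σ} = T_i T_σ when the length goes up.

Splitting Sym_l along cosets of the next Young subgroup produces the sums ∑_p x_p^a G[X - x_p] ∏_{j
≠ p} (x_p - t x_j)/(x_p - x_j), where X = x_{l+1} + ⋯ + x_n. The weights are those in the partial
fractions of Exp[(1-t)zX] = ∏ (1 - t x_j z)/(1 - x_j z). So, up to the factor 1 - t, the sum is
B_a(G)[X], minus t^(n-l) G[X] if a = 0 (`evSym_jing`, `symm_xr_pow_mul`).

This recursion carries both halves. For positive exponents there is no correction, and iteration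
gives Macdonald's formula (`symm_partMonomial`). For all exponents it shows that on 𝒫(k+1)⁺ the
idempotent ε_k^{(n)} is (∂_- - t^(n-k) C)/(1 - t^(n-k)), where C does not depend on n
(`partialIdempotent_realize_succ`). As n grows, t^(n-k) tends to 0; with ε_l ε_k = ε_l for l ≤ k,
induction descends from 𝒫(l+d)⁺ to 𝒫(l)⁺ (`asLimit_lowerTo`).

Limits are unique, because each coefficient converges in the Hausdorff t-adic topology
(`HasLimit.unique`). Hence composites of lowering operators with different starting points agree:
they are limits of the same sequence. -/

noncomputable section

namespace StableLimit

/-! ### Inversions and reduced words in the symmetric group -/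

section Words

open Equiv

variable {n : ℕ}

/-- The set of inversions of `σ`, recorded by values. -/
def inversions (σ : Perm (Fin n)) : Finset (Fin n × Fin n) :=
  {p | p.1 < p.2 ∧ σ⁻¹ p.2 < σ⁻¹ p.1}

theorem mem_inversions {σ : Perm (Fin n)} {p : Fin n × Fin n} :
    p ∈ inversions σ ↔ p.1 < p.2 ∧ σ⁻¹ p.2 < σ⁻¹ p.1 := by
  simp [inversions]

theorem SimpleIndex.lo_lt_hi (i : SimpleIndex n) : i.lo < i.hi := by
  simp [SimpleIndex.lo, SimpleIndex.hi, Fin.lt_def]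

theorem simpleRefl_lo (i : SimpleIndex n) : simpleRefl i i.lo = i.hi := swap_apply_left _ _

theorem simpleRefl_hi (i : SimpleIndex n) : simpleRefl i i.hi = i.lo := swap_apply_right _ _

theorem simpleRefl_mul_self (i : SimpleIndex n) : simpleRefl i * simpleRefl i = 1 :=
  swap_mul_self _ _

theorem simpleRefl_mul_cancel (i : SimpleIndex n) (σ : Perm (Fin n)) :
    simpleRefl i * (simpleRefl i * σ) = σ := by
  rw [← mul_assoc, simpleRefl_mul_self, one_mul]

theorem simpleRefl_inv (i : SimpleIndex n) : (simpleRefl i)⁻¹ = simpleRefl i := swap_inv _ _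

theorem simpleRefl_apply_self (i : SimpleIndex n) (a : Fin n) :
    simpleRefl i (simpleRefl i a) = a := by
  simp [simpleRefl]

theorem simpleRefl_mul_inv_apply (i : SimpleIndex n) (σ : Perm (Fin n)) (a : Fin n) :
    (simpleRefl i * σ)⁻¹ a = σ⁻¹ (simpleRefl i a) := by
  rw [mul_inv_rev, simpleRefl_inv, Perm.mul_apply]

theorem simpleRefl_of_ne (i : SimpleIndex n) {a : Fin n} (h : a ≠ i.lo) (h' : a ≠ i.hi) :
    simpleRefl i a = a := swap_apply_of_ne_of_ne h h'

theorem simpleRefl_lt_iff (i : SimpleIndex n) {a b : Fin n} (h : ¬ (a = i.lo ∧ b = i.hi))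
    (h' : ¬ (a = i.hi ∧ b = i.lo)) : simpleRefl i a < simpleRefl i b ↔ a < b := by
  simp only [simpleRefl, swap_apply_def, SimpleIndex.lo, SimpleIndex.hi, Fin.ext_iff,
    Fin.lt_def] at *
  split_ifs <;> simp_all <;> omega

/-- As inversions are recorded by values, left multiplication by s_i moves them by s_i itself. This
keeps the order of every pair except the two exchanged values, and that pair is the one new
inversion. -/
theorem card_inversions_simpleRefl_mul (i : SimpleIndex n) {σ : Perm (Fin n)}
    (h : σ⁻¹ i.lo < σ⁻¹ i.hi) :
    (inversions (simpleRefl i * σ)).card = (inversions σ).card + 1 := by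
  have key : inversions (simpleRefl i * σ) = insert (i.lo, i.hi)
      ((inversions σ).map (prodCongr (simpleRefl i) (simpleRefl i)).toEmbedding) := by
    ext ⟨a, b⟩
    have hm : (a, b) ∈ (inversions σ).map (prodCongr (simpleRefl i) (simpleRefl i)).toEmbedding ↔
        (simpleRefl i a, simpleRefl i b) ∈ inversions σ := by
      rw [Finset.mem_map_equiv]
      simp [simpleRefl]
    rw [Finset.mem_insert, hm, mem_inversions, mem_inversions]
    simp only [simpleRefl_mul_inv_apply, Prod.mk.injEq]
    by_cases h1 : a = i.lo ∧ b = i.hi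
    · obtain ⟨rfl, rfl⟩ := h1
      simp only [simpleRefl_lo, simpleRefl_hi, h, i.lo_lt_hi, and_self, true_or]
    · by_cases h2 : a = i.hi ∧ b = i.lo
      · obtain ⟨rfl, rfl⟩ := h2
        simp only [simpleRefl_lo, simpleRefl_hi, h.not_gt, i.lo_lt_hi.not_gt, i.lo_lt_hi.ne',
          false_and, and_false, or_false]
      · rw [simpleRefl_lt_iff i h1 h2]
        simp [h1]
  rw [key, Finset.card_insert_of_notMem, Finset.card_map]
  rw [Finset.mem_map_equiv]
  simp [simpleRefl, mem_inversions, i.lo_lt_hi.le]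

theorem card_inversions_of_descent (i : SimpleIndex n) {σ : Perm (Fin n)}
    (h : σ⁻¹ i.hi < σ⁻¹ i.lo) :
    (inversions σ).card = (inversions (simpleRefl i * σ)).card + 1 := by
  rw [← card_inversions_simpleRefl_mul i (σ := simpleRefl i * σ), simpleRefl_mul_cancel]
  rwa [simpleRefl_mul_inv_apply, simpleRefl_mul_inv_apply, simpleRefl_lo, simpleRefl_hi]

theorem ascent_or_descent (i : SimpleIndex n) (σ : Perm (Fin n)) :
    σ⁻¹ i.lo < σ⁻¹ i.hi ∨ σ⁻¹ i.hi < σ⁻¹ i.lo :=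
  lt_or_gt_of_ne fun e => i.lo_lt_hi.ne (σ⁻¹.injective e)

/-- Without descents σ⁻¹ is strictly increasing, and the identity is the only order automorphism of
`Fin n`. -/
theorem exists_descent {σ : Perm (Fin n)} (h : σ ≠ 1) :
    ∃ i : SimpleIndex n, σ⁻¹ i.hi < σ⁻¹ i.lo := by
  by_contra! hc
  apply h
  have hm : StrictMono (σ⁻¹ : Perm (Fin n)) := by
    cases n with
    | zero => exact fun a => a.elim0
    | succ n =>
      rw [Fin.strictMono_iff_lt_succ]
      intro i
      exact (hc ⟨i, by omega⟩).lt_of_ne fun e => (Fin.castSucc_lt_succ (i := i)).ne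
        (σ⁻¹.injective e)
  let e : Fin n ≃o Fin n := hm.orderIsoOfSurjective _ (σ⁻¹).surjective
  have he : e = OrderIso.refl _ := Subsingleton.elim _ _
  rw [← inv_eq_one]
  exact Perm.ext fun a => congrArg (fun f : Fin n ≃o Fin n => f a) he

theorem inversions_one : inversions (1 : Perm (Fin n)) = ∅ := by
  ext p
  simp only [mem_inversions, inv_one, Perm.coe_one, id, Finset.notMem_empty, iff_false]
  exact fun h => lt_asymm h.1 h.2

theorem exists_word_length (σ : Perm (Fin n)) : ∃ w : List (SimpleIndex n),
    (w.map simpleRefl).prod = σ ∧ w.length = (inversions σ).card := by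
  induction h : (inversions σ).card generalizing σ with
  | zero =>
    refine ⟨[], ?_, rfl⟩
    by_contra hne
    obtain ⟨i, hi⟩ := exists_descent (σ := σ) (fun e => hne (by simp [e]))
    have := card_inversions_of_descent i hi
    omega
  | succ N ih =>
    have hne : σ ≠ 1 := by
      rintro rfl
      simp [inversions_one] at h
    obtain ⟨i, hi⟩ := exists_descent hne
    obtain ⟨w, hw, hl⟩ := ih (simpleRefl i * σ) (by
      have := card_inversions_of_descent i hi
      omega)
    exact ⟨i :: w, by simp [hw, simpleRefl_mul_cancel], by simp [hl]⟩

theorem card_inversions_prod_le (w : List (SimpleIndex n)) :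
    (inversions (w.map simpleRefl).prod).card ≤ w.length := by
  induction w with
  | nil => simp [inversions_one]
  | cons i w ih =>
    simp only [List.map_cons, List.prod_cons, List.length_cons]
    rcases ascent_or_descent i (w.map simpleRefl).prod with h | h
    · rw [card_inversions_simpleRefl_mul i h]
      omega
    · have := card_inversions_of_descent i h
      omega

theorem reducedWord_prod (σ : Perm (Fin n)) : ((reducedWord σ).map simpleRefl).prod = σ :=
  (exists_reducedWord σ).choose_spec.1

/-- Stripping descents yields a word as long as the number of inversions; no word is shorter,
because a letter changes that number by one. Being reduced thus becomes a count of inversions. -/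
theorem len_eq_card_inversions (σ : Perm (Fin n)) : len σ = (inversions σ).card := by
  obtain ⟨w, hw, hl⟩ := exists_word_length σ
  refine le_antisymm (hl ▸ (exists_reducedWord σ).choose_spec.2 w hw) ?_
  conv_lhs => rw [← reducedWord_prod σ]
  exact card_inversions_prod_le _

theorem len_simpleRefl_mul (i : SimpleIndex n) {σ : Perm (Fin n)} (h : σ⁻¹ i.lo < σ⁻¹ i.hi) :
    len (simpleRefl i * σ) = len σ + 1 := by
  rw [len_eq_card_inversions, len_eq_card_inversions, card_inversions_simpleRefl_mul i h]

theorem len_one : len (1 : Perm (Fin n)) = 0 := by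
  rw [len_eq_card_inversions, inversions_one, Finset.card_empty]

theorem simpleRefl_comm {i j : SimpleIndex n} (h : i.1 + 1 < j.1) :
    simpleRefl i * simpleRefl j = simpleRefl j * simpleRefl i := by
  refine Perm.ext fun a => ?_
  simp only [Perm.mul_apply, simpleRefl, swap_apply_def, SimpleIndex.lo, SimpleIndex.hi]
  split_ifs <;> simp only [Fin.ext_iff] at * <;> omega

theorem simpleRefl_braid {i j : SimpleIndex n} (h : i.1 + 1 = j.1) :
    simpleRefl i * (simpleRefl j * simpleRefl i) =
      simpleRefl j * (simpleRefl i * simpleRefl j) := by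
  obtain ⟨i, hi⟩ := i
  obtain ⟨j, hj⟩ := j
  obtain rfl : i + 1 = j := h
  have h1 := swap_mul_swap_mul_swap (x := (⟨i, by omega⟩ : Fin n)) (y := ⟨i + 1, hi⟩)
    (z := ⟨i + 2, hj⟩) (by simp) (by simp)
  have h2 := swap_mul_swap_mul_swap (z := (⟨i, by omega⟩ : Fin n)) (y := ⟨i + 1, hi⟩)
    (x := ⟨i + 2, hj⟩) (by simp) (by simp)
  simp only [simpleRefl, SimpleIndex.lo, SimpleIndex.hi, ← mul_assoc]
  rw [swap_comm (⟨i + 1, hi⟩ : Fin n) ⟨i, _⟩, swap_comm (⟨i + 2, hj⟩ : Fin n) ⟨i + 1, _⟩,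
    swap_comm (⟨i, _⟩ : Fin n) ⟨i + 2, _⟩] at h2
  rw [h1, h2]

/-- **Matsumoto's theorem** for the symmetric group: the product along a reduced word of elements
that satisfy the braid relations only depends on the permutation. -/
theorem prod_eq_of_reduced {M : Type*} [Monoid M] (θ : SimpleIndex n → M)
    (hcomm : ∀ i j : SimpleIndex n, i.1 + 1 < j.1 → θ i * θ j = θ j * θ i)
    (hbraid : ∀ i j : SimpleIndex n, i.1 + 1 = j.1 → θ i * (θ j * θ i) = θ j * (θ i * θ j))
    (w w' : List (SimpleIndex n)) (hw : (inversions (w.map simpleRefl).prod).card = w.length)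
    (hl : w'.length = w.length) (hp : (w'.map simpleRefl).prod = (w.map simpleRefl).prod) :
    (w'.map θ).prod = (w.map θ).prod := by
  -- If `i :: u` is reduced, then its first letter raises the count, so `i` is an ascent of the
  -- product of `u`, and `u` is reduced too.
  have aux : ∀ N : ℕ, ∀ u : List (SimpleIndex n), ∀ i : SimpleIndex n, u.length = N →
      (inversions (simpleRefl i * (u.map simpleRefl).prod)).card = N + 1 →
      (u.map simpleRefl).prod⁻¹ i.lo < (u.map simpleRefl).prod⁻¹ i.hi ∧
        (inversions (u.map simpleRefl).prod).card = N := by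
    intro N u i hu h
    rcases ascent_or_descent i (u.map simpleRefl).prod with h1 | h1
    · exact ⟨h1, by have := card_inversions_simpleRefl_mul i h1; omega⟩
    · have := card_inversions_of_descent i h1
      have := card_inversions_prod_le u
      omega
  induction hN : w.length using Nat.strong_induction_on generalizing w w' with
  | _ N ih =>
  rw [hN] at hw hl
  -- Two reduced words `i :: u` and `j :: v` of one permutation, with i < j. Both letters are
  -- descents, so there are also reduced words with the same tail `z` that begin with the two sides
  -- of the commutation or braid relation. The induction hypothesis replaces `u` and `v` by the rest
  -- of these words.
  have step : ∀ (i j : SimpleIndex n) (u v : List (SimpleIndex n)), u.length + 1 = N →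
      v.length + 1 = N → i.1 < j.1 →
      ∀ U V : Equiv.Perm (Fin n), (u.map simpleRefl).prod = U → (v.map simpleRefl).prod = V →
      V = simpleRefl j * (simpleRefl i * U) →
      U⁻¹ i.lo < U⁻¹ i.hi → V⁻¹ j.lo < V⁻¹ j.hi →
      (inversions U).card + 1 = N → (inversions V).card + 1 = N →
      θ j * (v.map θ).prod = θ i * (u.map θ).prod := by
    intro i j u v hul hvl hij U V hu hv hV hiu hjv hU hV'
    have hxy := i.lo_lt_hi.ne
    rcases Nat.lt_or_ge (i.1 + 1) j.1 with hc | hc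
    · have hn : i.lo ≠ j.lo ∧ i.lo ≠ j.hi ∧ i.hi ≠ j.lo ∧ i.hi ≠ j.hi := by
        simp only [SimpleIndex.lo, SimpleIndex.hi, ne_eq, Fin.ext_iff]
        omega
      have hd : U⁻¹ j.hi < U⁻¹ j.lo := by
        rw [hV, simpleRefl_mul_inv_apply, simpleRefl_mul_inv_apply, simpleRefl_mul_inv_apply,
          simpleRefl_mul_inv_apply, simpleRefl_lo, simpleRefl_hi,
          simpleRefl_of_ne i hn.2.1.symm hn.2.2.2.symm,
          simpleRefl_of_ne i hn.1.symm hn.2.2.1.symm] at hjv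
        exact hjv
      have h1 := card_inversions_of_descent j hd
      obtain ⟨z, hz, hzl⟩ := exists_word_length (simpleRefl j * U)
      have hu' : ((j :: z).map θ).prod = (u.map θ).prod := by
        refine ih (u.length) (by omega) u (j :: z) ?_ ?_ ?_ rfl
        · rw [hu]; omega
        · simp only [List.length_cons]; omega
        · simp [hz, simpleRefl_mul_cancel, hu]
      have hv' : ((i :: z).map θ).prod = (v.map θ).prod := by
        refine ih (v.length) (by omega) v (i :: z) ?_ ?_ ?_ rfl
        · rw [hv]; omega
        · simp only [List.length_cons]; omega
        · simp only [List.map_cons, List.prod_cons, hz, hv]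
          rw [hV, ← mul_assoc, ← mul_assoc, simpleRefl_comm hc]
      rw [← hu', ← hv']
      simp only [List.map_cons, List.prod_cons]
      rw [← mul_assoc, ← mul_assoc, hcomm i j hc]
    · have hc' : i.1 + 1 = j.1 := by omega
      have hmid : j.lo = i.hi := by simp [SimpleIndex.lo, SimpleIndex.hi, hc']
      have hne2 : i.lo ≠ j.hi := by
        simp only [SimpleIndex.lo, SimpleIndex.hi, ne_eq, Fin.ext_iff]; omega
      have hne3 : j.hi ≠ i.hi := by simp only [SimpleIndex.hi, ne_eq, Fin.ext_iff]; omega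
      have hjx : simpleRefl j i.lo = i.lo := simpleRefl_of_ne j (hmid ▸ hxy) hne2
      have hjy : simpleRefl j i.hi = j.hi := by rw [← hmid, simpleRefl_lo]
      have hiz : simpleRefl i j.hi = j.hi := simpleRefl_of_ne i hne2.symm hne3
      -- The ascent of V at `j`, pulled back along s_j s_i, compares the outer two of the three
      -- values involved. With the ascent of U at `i`, this allows first `j` and then `i` to be
      -- stripped from U.
      have hcb : U⁻¹ j.hi < U⁻¹ i.lo := by
        rw [hV, hmid] at hjv
        simp only [simpleRefl_mul_inv_apply, simpleRefl_hi, hjy, hmid, hiz] at hjv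
        exact hjv
      have hU1 := card_inversions_of_descent j (σ := U) (by rw [hmid]; exact hcb.trans hiu)
      have hU2 := card_inversions_of_descent i (σ := simpleRefl j * U) (by
        simpa only [simpleRefl_mul_inv_apply, hjy, hjx] using hcb)
      have hV1 := card_inversions_of_descent i (σ := V) (by
        rw [hV]
        simp only [simpleRefl_mul_inv_apply, hjy, hjx, hiz, simpleRefl_lo]
        exact hcb.trans hiu)
      obtain ⟨z, hz, hzl⟩ := exists_word_length (simpleRefl i * (simpleRefl j * U))
      have hu' : ((j :: i :: z).map θ).prod = (u.map θ).prod := by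
        refine ih (u.length) (by omega) u (j :: i :: z) ?_ ?_ ?_ rfl
        · rw [hu]; omega
        · simp only [List.length_cons]; omega
        · simp [hz, simpleRefl_mul_cancel, hu]
      have hv' : ((i :: j :: z).map θ).prod = (v.map θ).prod := by
        refine ih (v.length) (by omega) v (i :: j :: z) ?_ ?_ ?_ rfl
        · rw [hv]; omega
        · simp only [List.length_cons]; omega
        · simp only [List.map_cons, List.prod_cons, hz, hv]
          have := congrArg (· * (simpleRefl j * U)) (simpleRefl_braid hc')
          simp only [mul_assoc, simpleRefl_mul_cancel] at this
          rw [hV, this]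
      rw [← hu', ← hv']
      simp only [List.map_cons, List.prod_cons]
      have := congrArg (· * (z.map θ).prod) (hbraid i j hc')
      simpa only [mul_assoc] using this.symm
  rcases w with _ | ⟨i, u⟩
  · simp only [List.length_nil] at hN
    rw [List.length_eq_zero_iff.1 (hl.trans hN.symm)]
  rcases w' with _ | ⟨j, v⟩
  · simp only [List.length_nil, List.length_cons] at hN hl
    omega
  simp only [List.length_cons] at hN hl
  simp only [List.map_cons, List.prod_cons] at hw hp ⊢
  obtain ⟨hiu, hu⟩ := aux u.length u i rfl (by omega)
  obtain ⟨hjv, hv⟩ := aux v.length v j rfl (by rw [hp]; omega)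
  by_cases hij : i = j
  · subst hij
    rw [ih u.length (by omega) u v (by omega) (by omega) (mul_left_cancel hp) rfl]
  rcases lt_or_gt_of_ne (fun e => hij (Subtype.ext e) : i.1 ≠ j.1) with h | h
  · exact step i j u v hN hl h _ _ rfl rfl (by rw [← hp, simpleRefl_mul_cancel]) hiu hjv
      (by omega) (by omega)
  · exact (step j i v u hl hN h _ _ rfl rfl (by rw [hp, simpleRefl_mul_cancel]) hjv hiu
      (by omega) (by omega)).symm

end Words

/-! ### Young subgroups and the Poincaré polynomial -/

theorem t_ne_zero : t ≠ 0 := RatFunc.X_ne_zero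

theorem one_sub_t_pow_ne_zero {m : ℕ} (hm : m ≠ 0) : 1 - t ^ m ≠ 0 := by
  intro h
  have h1 : algebraMap (Polynomial (RatFunc ℚ)) K (1 - Polynomial.X ^ m) = algebraMap _ K 0 := by
    rw [map_zero, ← h, t, map_sub, map_one, map_pow, RatFunc.algebraMap_X]
  have h2 := RatFunc.algebraMap_injective (RatFunc ℚ) h1
  have := congrArg (Polynomial.eval 0) h2
  simp [hm] at this

theorem one_sub_t_ne_zero : 1 - t ≠ 0 := by
  simpa using one_sub_t_pow_ne_zero one_ne_zero

theorem tFactorial_zero : tFactorial 0 = 1 := by simp [tFactorial]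

theorem tFactorial_succ (m : ℕ) :
    tFactorial (m + 1) = tFactorial m * ((1 - t ^ (m + 1)) / (1 - t)) := by
  rw [tFactorial, Finset.prod_Icc_succ_top (by omega), tFactorial]

theorem tFactorial_ne_zero (m : ℕ) : tFactorial m ≠ 0 := by
  rw [tFactorial, Finset.prod_ne_zero_iff]
  intro i hi
  exact div_ne_zero (one_sub_t_pow_ne_zero (by have := (Finset.mem_Icc.1 hi).1; omega))
    one_sub_t_ne_zero

section Young

open Equiv

variable {n : ℕ}

/-- The positions `i` with `l ≤ i`. -/
def tail (l n : ℕ) : Finset (Fin n) := {i | l ≤ (i : ℕ)}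

theorem mem_tail {l : ℕ} {i : Fin n} : i ∈ tail l n ↔ l ≤ (i : ℕ) := by simp [tail]

theorem tail_eq_empty {l : ℕ} (h : n ≤ l) : tail l n = ∅ := by
  ext i
  simp only [mem_tail, Finset.notMem_empty, iff_false]
  omega

theorem tail_eq_insert {l : ℕ} (h : l < n) : tail l n = insert ⟨l, h⟩ (tail (l + 1) n) := by
  ext i
  simp only [mem_tail, Finset.mem_insert, Fin.ext_iff]
  omega

theorem notMem_tail_succ {l : ℕ} (h : l < n) : (⟨l, h⟩ : Fin n) ∉ tail (l + 1) n := by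
  simp [mem_tail]

theorem card_tail (l : ℕ) : (tail l n).card = n - l := by
  induction h : n - l generalizing l with
  | zero => rw [tail_eq_empty (by omega), Finset.card_empty]
  | succ m ih =>
    rw [tail_eq_insert (show l < n by omega), Finset.card_insert_of_notMem (notMem_tail_succ _),
      ih (l + 1) (by omega)]

theorem mem_young {l : ℕ} {σ : Perm (Fin n)} :
    σ ∈ young l n ↔ ∀ i : Fin n, (i : ℕ) < l → σ i = i := by simp [young]

theorem one_mem_young (l : ℕ) : (1 : Perm (Fin n)) ∈ young l n := by simp [mem_young]

theorem mul_mem_young {l : ℕ} {σ τ : Perm (Fin n)} (hσ : σ ∈ young l n) (hτ : τ ∈ young l n) :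
    σ * τ ∈ young l n := by
  rw [mem_young] at *
  intro i hi
  rw [Perm.mul_apply, hτ i hi, hσ i hi]

theorem inv_mem_young {l : ℕ} {σ : Perm (Fin n)} (hσ : σ ∈ young l n) : σ⁻¹ ∈ young l n := by
  rw [mem_young] at *
  intro i hi
  rw [Perm.inv_eq_iff_eq, hσ i hi]

theorem young_mono {k l : ℕ} (h : k ≤ l) : young l n ⊆ young k n := by
  intro σ hσ
  rw [mem_young] at *
  exact fun i hi => hσ i (by omega)

theorem apply_mem_tail {l : ℕ} {σ : Perm (Fin n)} (hσ : σ ∈ young l n) {i : Fin n}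
    (hi : i ∈ tail l n) : σ i ∈ tail l n := by
  rw [mem_tail] at *
  by_contra hc
  have := σ.injective (mem_young.1 hσ (σ i) (by omega))
  rw [this] at hc
  omega

theorem simpleRefl_mem_young {l : ℕ} (i : SimpleIndex n) (h : l ≤ i.1) :
    simpleRefl i ∈ young l n := by
  rw [mem_young]
  intro a ha
  apply simpleRefl_of_ne <;> simp only [SimpleIndex.lo, SimpleIndex.hi, ne_eq, Fin.ext_iff] <;>
    omega

theorem swap_mem_young {l : ℕ} {i j : Fin n} (hi : i ∈ tail l n) (hj : j ∈ tail l n) :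
    swap i j ∈ young l n := by
  rw [mem_tail] at hi hj
  rw [mem_young]
  intro a ha
  apply swap_apply_of_ne_of_ne <;> rintro rfl <;> omega

theorem young_eq_one {l : ℕ} (h : n ≤ l) : young l n = {1} := by
  ext σ
  rw [mem_young, Finset.mem_singleton]
  exact ⟨fun h' => Perm.ext fun i => h' i (by omega), fun h' => by simp [h']⟩

/-- A coset of the next Young subgroup is determined by the image p of position l. The transversal
is left free: cycles add lengths, which suits the Poincaré polynomial, and transpositions are
simpler for symmetrizers. -/
theorem sum_young {M : Type*} [AddCommMonoid M] {l : ℕ} (h : l < n) (c : Fin n → Perm (Fin n))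
    (hc : ∀ p ∈ tail l n, c p ∈ young l n ∧ c p ⟨l, h⟩ = p) (F : Perm (Fin n) → M) :
    ∑ w ∈ young l n, F w = ∑ p ∈ tail l n, ∑ v ∈ young (l + 1) n, F (c p * v) := by
  rw [← Finset.sum_product']
  have hl : (⟨l, h⟩ : Fin n) ∈ tail l n := by simp [mem_tail]
  have hv : ∀ {v : Perm (Fin n)}, v ∈ young (l + 1) n → v ⟨l, h⟩ = ⟨l, h⟩ :=
    fun hv => mem_young.1 hv _ (by simp)
  symm
  refine Finset.sum_nbij' (fun x => c x.1 * x.2) (fun w => (w ⟨l, h⟩, (c (w ⟨l, h⟩))⁻¹ * w))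
    ?_ ?_ ?_ ?_ ?_
  · intro x hx
    rw [Finset.mem_product] at hx
    exact mul_mem_young (hc _ hx.1).1 (young_mono l.le_succ hx.2)
  · intro w hw
    have hp := apply_mem_tail hw hl
    rw [Finset.mem_product]
    refine ⟨hp, mem_young.2 fun i hi => ?_⟩
    rcases Nat.lt_succ_iff_lt_or_eq.1 hi with h1 | h1
    · rw [Perm.mul_apply, mem_young.1 hw i h1,
        mem_young.1 (inv_mem_young (hc _ hp).1) i h1]
    · obtain rfl : i = ⟨l, h⟩ := Fin.ext h1
      rw [Perm.mul_apply, Perm.inv_eq_iff_eq, (hc _ hp).2]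
  · intro x hx
    rw [Finset.mem_product] at hx
    simp only [Perm.mul_apply, hv hx.2, (hc _ hx.1).2]
    simp
  · intro w _
    simp
  · intro x _
    rfl

/-- The cycle `s_{l+d-1} ⋯ s_{l+1} s_l`, which moves the position `l` to `l + d`. -/
def shiftCycle (n l : ℕ) : ℕ → Perm (Fin n)
  | 0 => 1
  | d + 1 => if h : l + d + 1 < n then simpleRefl ⟨l + d, h⟩ * shiftCycle n l d else 1

theorem shiftCycle_succ {l d : ℕ} (h : l + d + 1 < n) :
    shiftCycle n l (d + 1) = simpleRefl ⟨l + d, h⟩ * shiftCycle n l d := by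
  rw [shiftCycle, dif_pos h]

theorem shiftCycle_spec {l d : ℕ} (h : l + d < n) :
    shiftCycle n l d ∈ young l n ∧ shiftCycle n l d ⟨l, by omega⟩ = ⟨l + d, h⟩ ∧
      ∀ a : Fin n, l + d < (a : ℕ) → shiftCycle n l d a = a := by
  induction d with
  | zero => exact ⟨one_mem_young l, rfl, fun _ _ => rfl⟩
  | succ d ih =>
    obtain ⟨h1, h2, h3⟩ := ih (by omega)
    rw [shiftCycle_succ (by omega)]
    refine ⟨mul_mem_young (simpleRefl_mem_young _ (by simp)) h1, ?_, fun a ha => ?_⟩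
    · rw [Perm.mul_apply, h2]
      exact simpleRefl_lo _
    · rw [Perm.mul_apply, h3 a (by omega)]
      apply simpleRefl_of_ne <;>
        simp only [SimpleIndex.lo, SimpleIndex.hi, ne_eq, Fin.ext_iff] <;> omega

/-- The cycles are minimal coset representatives. When the letter s_{l+d} is added, the value l+d
comes from position l and the value l+d+1 from a later position, so the letter is an ascent. -/
theorem len_shiftCycle_mul {l d : ℕ} (h : l + d < n) {σ : Perm (Fin n)}
    (hσ : σ ∈ young (l + 1) n) : len (shiftCycle n l d * σ) = d + len σ := by
  induction d with
  | zero => simp [shiftCycle]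
  | succ d ih =>
    obtain ⟨-, h2, h3⟩ := shiftCycle_spec (n := n) (l := l) (d := d) (by omega)
    rw [shiftCycle_succ (by omega), mul_assoc, len_simpleRefl_mul, ih (by omega)]
    · omega
    · have e1 : (shiftCycle n l d * σ)⁻¹ ⟨l + d, by omega⟩ = ⟨l, by omega⟩ := by
        rw [Perm.inv_eq_iff_eq, Perm.mul_apply, mem_young.1 hσ _ (by simp), h2]
      have e2 : (shiftCycle n l d * σ)⁻¹ ⟨l + d + 1, h⟩ ∈ tail (l + 1) n := by
        rw [mul_inv_rev, Perm.mul_apply]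
        have : (shiftCycle n l d)⁻¹ ⟨l + d + 1, h⟩ = ⟨l + d + 1, h⟩ := by
          rw [Perm.inv_eq_iff_eq, h3 _ (by simp)]
        rw [this]
        exact apply_mem_tail (inv_mem_young hσ) (by simp [mem_tail])
      rw [mem_tail] at e2
      change (shiftCycle n l d * σ)⁻¹ ⟨l + d, _⟩ < (shiftCycle n l d * σ)⁻¹ ⟨l + d + 1, _⟩
      rw [e1, Fin.lt_def]
      exact e2

theorem sum_tail {M : Type*} [AddCommMonoid M] (l : ℕ) (f : ℕ → M) :
    ∑ p ∈ tail l n, f ((p : ℕ) - l) = ∑ d ∈ Finset.range (n - l), f d := by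
  refine Finset.sum_bij (fun p _ => (p : ℕ) - l) ?_ ?_ ?_ ?_
  · intro p hp
    rw [mem_tail] at hp
    rw [Finset.mem_range]
    omega
  · intro p hp q hq hpq
    rw [mem_tail] at hp hq
    exact Fin.ext (by omega)
  · intro d hd
    rw [Finset.mem_range] at hd
    exact ⟨⟨l + d, by omega⟩, by simp [mem_tail], by simp⟩
  · intro _ _
    rfl

/-- The Poincaré polynomial of a Young subgroup. -/
theorem sum_young_t_pow_len {l : ℕ} (hl : l ≤ n) :
    ∑ σ ∈ young l n, t ^ (((n - l).choose 2 : ℤ) - (len σ : ℤ)) = tFactorial (n - l) := by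
  have ht := t_ne_zero
  induction hm : n - l generalizing l with
  | zero => simp [young_eq_one (show n ≤ l by omega), len_one, tFactorial_zero]
  | succ m ih =>
    have h : l < n := by omega
    rw [sum_young h (fun p => shiftCycle n l (p - l))]
    · have : ∀ p ∈ tail l n, ∑ v ∈ young (l + 1) n,
          t ^ (((m + 1).choose 2 : ℤ) - (len (shiftCycle n l (p - l) * v) : ℤ)) =
            t ^ ((m : ℤ) - ((p - l : ℕ) : ℤ)) * tFactorial m := by
        intro p hp
        rw [mem_tail] at hp
        rw [← ih (l := l + 1) (by omega) (by omega), Finset.mul_sum]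
        refine Finset.sum_congr rfl fun v hv => ?_
        rw [len_shiftCycle_mul (by omega) hv, ← zpow_add₀ ht]
        congr 1
        rw [Nat.choose_succ_succ' m 1, Nat.choose_one_right]
        push_cast
        ring
      rw [Finset.sum_congr rfl this, ← Finset.sum_mul,
        sum_tail l fun d : ℕ => t ^ ((m : ℤ) - (d : ℤ)), hm, tFactorial_succ, mul_comm]
      congr 1
      rw [← Finset.sum_range_reflect, eq_div_iff one_sub_t_ne_zero, ← geom_sum_mul_neg t (m + 1)]
      congr 1
      refine Finset.sum_congr rfl fun d hd => ?_
      rw [Finset.mem_range] at hd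
      rw [← zpow_natCast]
      congr 1
      omega
    · intro p hp
      rw [mem_tail] at hp
      obtain ⟨h1, h2, -⟩ := shiftCycle_spec (n := n) (l := l) (d := p - l) (by omega)
      exact ⟨h1, h2.trans (Fin.ext (by simp only; omega))⟩

end Young

/-! ### Demazure–Lusztig operators on rational functions -/

section Rational

open Equiv

variable {n : ℕ}

/-- The field of rational functions in `x_1, …, x_n`. -/
abbrev Rat (n : ℕ) : Type := FractionRing (Pol n)

/-- The inclusion of polynomials into rational functions. -/
def toRat (n : ℕ) : Pol n →ₐ[K] Rat n := Algebra.algHom K (Pol n) (Rat n)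

theorem toRat_injective : Function.Injective (toRat n) :=
  IsFractionRing.injective (Pol n) (Rat n)

theorem toRat_eq (f : Pol n) : algebraMap (Pol n) (Rat n) f = toRat n f := rfl

theorem permAlgHom_injective (w : Perm (Fin n)) :
    Function.Injective ((toRat n).comp (MvPolynomial.rename w)) :=
  toRat_injective.comp (MvPolynomial.rename_injective w w.injective)

/-- The action of permutations on rational functions. -/
def act (w : Perm (Fin n)) : Rat n →ₐ[K] Rat n :=
  IsFractionRing.liftAlgHom (permAlgHom_injective w)

theorem act_toRat (w : Perm (Fin n)) (f : Pol n) :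
    act w (toRat n f) = toRat n (MvPolynomial.rename w f) :=
  IsFractionRing.lift_algebraMap (permAlgHom_injective w) f

theorem act_mul (w v : Perm (Fin n)) (F : Rat n) : act (w * v) F = act w (act v F) := by
  obtain ⟨a, b, -, rfl⟩ := IsFractionRing.div_surjective (A := Pol n) F
  simp only [map_div₀, toRat_eq, act_toRat, MvPolynomial.rename_rename, Perm.coe_mul]

theorem act_one (F : Rat n) : act 1 F = F := by
  obtain ⟨a, b, -, rfl⟩ := IsFractionRing.div_surjective (A := Pol n) F
  simp only [map_div₀, toRat_eq, act_toRat, Perm.coe_one, MvPolynomial.rename_id_apply]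

/-- The variable `x_{i+1}` as a rational function. -/
def xr (i : Fin n) : Rat n := toRat n (MvPolynomial.X i)

theorem act_xr (w : Perm (Fin n)) (i : Fin n) : act w (xr i) = xr (w i) := by
  rw [xr, act_toRat, MvPolynomial.rename_X, xr]

theorem xr_injective : Function.Injective (xr (n := n)) :=
  toRat_injective.comp (MvPolynomial.X_injective)

theorem xr_ne_zero (i : Fin n) : xr i ≠ 0 := fun h =>
  MvPolynomial.X_ne_zero i (toRat_injective (h.trans (map_zero _).symm))

theorem xr_sub_ne_zero {i j : Fin n} (h : i ≠ j) : xr i - xr j ≠ 0 :=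
  sub_ne_zero.2 fun e => h (xr_injective e)

/-- The parameter `t` as a rational function. -/
def tr (n : ℕ) : Rat n := algebraMap K (Rat n) t

theorem act_tr (w : Perm (Fin n)) : act w (tr n) = tr n := AlgHom.commutes _ _

theorem act_simpleRefl_self (i : SimpleIndex n) (F : Rat n) :
    act (simpleRefl i) (act (simpleRefl i) F) = F := by
  rw [← act_mul, simpleRefl_mul_self, act_one]

theorem toRat_divDiff {i j : Fin n} (h : i ≠ j) (f : Pol n) :
    toRat n (divDiff i j f) = (toRat n f - act (swap i j) (toRat n f)) / (xr i - xr j) := by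
  rw [eq_div_iff (xr_sub_ne_zero h), act_toRat, xr, xr, ← map_sub, ← map_sub, ← map_mul, mul_comm]
  exact congrArg _ (sub_dvd_sub_swap i j f).choose_spec.symm

/-- The Demazure–Lusztig operator on rational functions. -/
def ratT (i : SimpleIndex n) (F : Rat n) : Rat n :=
  (1 - tr n) * xr i.lo / (xr i.lo - xr i.hi) * F +
    (tr n * xr i.lo - xr i.hi) / (xr i.lo - xr i.hi) * act (simpleRefl i) F

/-- The coefficient of s_i f collects to (t x_i - x_{i+1})/(x_i - x_{i+1}). Over the field, braid
relations become identities of rational functions, and injectivity of `toRat` brings them back to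
polynomials. -/
theorem toRat_demazureLusztig (i : SimpleIndex n) (f : Pol n) :
    toRat n (demazureLusztig i f) = ratT i (toRat n f) := by
  have h := xr_sub_ne_zero i.lo_lt_hi.ne
  rw [demazureLusztig, map_add, map_mul, map_mul, toRat_divDiff i.lo_lt_hi.ne, ratT, ← act_toRat]
  rw [show toRat n (MvPolynomial.C (1 - t)) = 1 - tr n by
    rw [tr, ← map_one (algebraMap K (Rat n)), ← map_sub]; exact AlgHom.commutes _ _]
  rw [← xr]
  change _ + (1 - tr n) * xr i.lo * ((toRat n f - act (simpleRefl i) (toRat n f)) / _) = _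
  field_simp
  ring

theorem ratT_comm {i j : SimpleIndex n} (h : i.1 + 1 < j.1) (F : Rat n) :
    ratT i (ratT j F) = ratT j (ratT i F) := by
  have hn : i.lo ≠ j.lo ∧ i.lo ≠ j.hi ∧ i.hi ≠ j.lo ∧ i.hi ≠ j.hi := by
    simp only [SimpleIndex.lo, SimpleIndex.hi, ne_eq, Fin.ext_iff]
    omega
  simp only [ratT, map_add, map_mul, map_div₀, map_sub, map_one, act_tr, act_xr,
    simpleRefl_of_ne i hn.1.symm hn.2.2.1.symm, simpleRefl_of_ne i hn.2.1.symm hn.2.2.2.symm,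
    simpleRefl_of_ne j hn.1 hn.2.1, simpleRefl_of_ne j hn.2.2.1 hn.2.2.2]
  rw [← act_mul, ← act_mul, simpleRefl_comm h]
  ring

theorem ratT_braid {i j : SimpleIndex n} (h : i.1 + 1 = j.1) (F : Rat n) :
    ratT i (ratT j (ratT i F)) = ratT j (ratT i (ratT j F)) := by
  have hxy := i.lo_lt_hi.ne
  have hmid : j.lo = i.hi := by simp [SimpleIndex.lo, SimpleIndex.hi, h]
  have hne2 : i.lo ≠ j.hi := by
    simp only [SimpleIndex.lo, SimpleIndex.hi, ne_eq, Fin.ext_iff]; omega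
  have hne3 : j.hi ≠ i.hi := by simp only [SimpleIndex.hi, ne_eq, Fin.ext_iff]; omega
  have hjx : simpleRefl j i.lo = i.lo := simpleRefl_of_ne j (hmid ▸ hxy) hne2
  have hjy : simpleRefl j i.hi = j.hi := by rw [← hmid, simpleRefl_lo]
  have hjz : simpleRefl j j.hi = i.hi := by rw [← hmid, simpleRefl_hi]
  have hiz : simpleRefl i j.hi = j.hi := simpleRefl_of_ne i hne2.symm hne3
  have hb : act (simpleRefl i) (act (simpleRefl j) (act (simpleRefl i) F)) =
      act (simpleRefl j) (act (simpleRefl i) (act (simpleRefl j) F)) := by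
    rw [← act_mul, ← act_mul, ← act_mul, ← act_mul, mul_assoc, mul_assoc, simpleRefl_braid h]
  simp only [ratT, map_add, map_mul, map_div₀, map_sub, map_one, act_tr, act_xr, hmid,
    simpleRefl_lo, simpleRefl_hi, hjx, hjy, hjz, hiz, hb, act_simpleRefl_self]
  have h1 := xr_sub_ne_zero hxy
  have h2 := xr_sub_ne_zero hne2
  have h3 := xr_sub_ne_zero hne3.symm
  have h1' := xr_sub_ne_zero hxy.symm
  have h2' := xr_sub_ne_zero hne2.symm
  have h3' := xr_sub_ne_zero hne3
  generalize xr i.lo = x at *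
  generalize xr i.hi = y at *
  generalize xr j.hi = z at *
  have e1 : y - x = -(x - y) := by ring
  have e2 : z - x = -(x - z) := by ring
  have e3 : z - y = -(y - z) := by ring
  rw [e1]
  try rw [e2]
  try rw [e3]
  -- The translates of F under the six permutations become independent unknowns; what remains is a
  -- rational identity in x, y, z for each coefficient.
  generalize act (simpleRefl j) (act (simpleRefl i) (act (simpleRefl j) F)) = F₆
  generalize act (simpleRefl j) (act (simpleRefl i) F) = F₅
  generalize act (simpleRefl i) (act (simpleRefl j) F) = F₄
  generalize act (simpleRefl j) F = F₃
  generalize act (simpleRefl i) F = F₂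
  field_simp
  ring

theorem demazureLusztig_comm {i j : SimpleIndex n} (h : i.1 + 1 < j.1) (f : Pol n) :
    demazureLusztig i (demazureLusztig j f) = demazureLusztig j (demazureLusztig i f) :=
  toRat_injective (by simp only [toRat_demazureLusztig, ratT_comm h])

theorem demazureLusztig_braid {i j : SimpleIndex n} (h : i.1 + 1 = j.1) (f : Pol n) :
    demazureLusztig i (demazureLusztig j (demazureLusztig i f)) =
      demazureLusztig j (demazureLusztig i (demazureLusztig j f)) :=
  toRat_injective (by simp only [toRat_demazureLusztig, ratT_braid h])

/-- Matsumoto's theorem in the monoid of self-maps of `Pol n`: the chosen reduced word may be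
replaced by any other. -/
theorem heckeT_eq_foldr (σ : Perm (Fin n)) (w : List (SimpleIndex n))
    (hw : (w.map simpleRefl).prod = σ) (hl : w.length = len σ) (f : Pol n) :
    heckeT σ f = w.foldr demazureLusztig f := by
  let θ : SimpleIndex n → Function.End (Pol n) := demazureLusztig
  have hfold : ∀ u : List (SimpleIndex n), (u.map θ).prod f = u.foldr demazureLusztig f := by
    intro u
    induction u with
    | nil => rfl
    | cons i u ih =>
      rw [List.map_cons, List.prod_cons, List.foldr_cons, ← ih]
      rfl
  rw [heckeT, ← hfold, ← hfold]
  refine congrFun (prod_eq_of_reduced θ (fun i j h => funext (demazureLusztig_comm h))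
    (fun i j h => funext (demazureLusztig_braid h)) w (reducedWord σ) ?_ hl.symm ?_) f
  · rw [hw, hl, len_eq_card_inversions]
  · rw [hw, reducedWord_prod]

theorem heckeT_simpleRefl_mul (i : SimpleIndex n) {σ : Perm (Fin n)} (h : σ⁻¹ i.lo < σ⁻¹ i.hi)
    (f : Pol n) : heckeT (simpleRefl i * σ) f = demazureLusztig i (heckeT σ f) := by
  rw [heckeT_eq_foldr _ (i :: reducedWord σ) (by simp [reducedWord_prod])
    (by rw [len_simpleRefl_mul i h]; rfl)]
  rfl

theorem heckeT_one (f : Pol n) : heckeT 1 f = f :=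
  heckeT_eq_foldr 1 [] rfl len_one.symm f

end Rational

/-! ### The symmetrizer -/

section Symmetrizer

open Equiv

variable {n : ℕ}

theorem sum_young_mul_left {M : Type*} [AddCommMonoid M] {l : ℕ} {v : Perm (Fin n)}
    (hv : v ∈ young l n) (F : Perm (Fin n) → M) :
    ∑ w ∈ young l n, F (v * w) = ∑ w ∈ young l n, F w :=
  Finset.sum_nbij' (fun w => v * w) (fun w => v⁻¹ * w) (fun _ hw => mul_mem_young hv hw)
    (fun _ hw => mul_mem_young (inv_mem_young hv) hw) (by simp) (by simp) (by simp)

theorem sum_young_mul_right {M : Type*} [AddCommMonoid M] {l : ℕ} {v : Perm (Fin n)}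
    (hv : v ∈ young l n) (F : Perm (Fin n) → M) :
    ∑ w ∈ young l n, F (w * v) = ∑ w ∈ young l n, F w :=
  Finset.sum_nbij' (fun w => w * v) (fun w => w * v⁻¹) (fun _ hw => mul_mem_young hw hv)
    (fun _ hw => mul_mem_young hw (inv_mem_young hv)) (by simp) (by simp) (by simp)

theorem perm_apply_inv (σ : Perm (Fin n)) (a : Fin n) : σ (σ⁻¹ a) = a := σ.apply_symm_apply a

theorem perm_inv_apply (σ : Perm (Fin n)) (a : Fin n) : σ⁻¹ (σ a) = a := σ.symm_apply_apply a

theorem act_smul (w : Perm (Fin n)) (c : K) (F : Rat n) : act w (c • F) = c • act w F := by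
  rw [Algebra.smul_def, map_mul, AlgHom.commutes, ← Algebra.smul_def]

/-- If i < l, then i is a fixed position, and a descent there would put the preimage of i+1 below l,
where σ is the identity. So stripping descents never leaves the Young subgroup, which gives
`young_induction`. -/
theorem descent_index_le {l : ℕ} {σ : Perm (Fin n)} (hσ : σ ∈ young l n) {i : SimpleIndex n}
    (h : σ⁻¹ i.hi < σ⁻¹ i.lo) : l ≤ i.1 := by
  by_contra hc
  have h1 : σ⁻¹ i.lo = i.lo := mem_young.1 (inv_mem_young hσ) _ (by simpa [SimpleIndex.lo] using hc)
  rw [h1] at h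
  have h2 : ((σ⁻¹ i.hi : Fin n) : ℕ) < l := by
    rw [Fin.lt_def] at h
    simp only [SimpleIndex.lo] at h
    omega
  have h3 := mem_young.1 hσ _ h2
  rw [perm_apply_inv] at h3
  rw [← h3] at h
  exact lt_asymm h i.lo_lt_hi

theorem young_induction {l : ℕ} {P : Perm (Fin n) → Prop} (one : P 1)
    (step : ∀ i : SimpleIndex n, l ≤ i.1 → ∀ σ ∈ young l n, σ⁻¹ i.lo < σ⁻¹ i.hi → P σ →
      P (simpleRefl i * σ)) (σ : Perm (Fin n)) (hσ : σ ∈ young l n) : P σ := by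
  induction h : (inversions σ).card generalizing σ with
  | zero =>
    by_cases h1 : σ = 1
    · rwa [h1]
    · obtain ⟨i, hi⟩ := exists_descent h1
      have := card_inversions_of_descent i hi
      omega
  | succ N ih =>
    have hne : σ ≠ 1 := by
      rintro rfl
      simp [inversions_one] at h
    obtain ⟨i, hi⟩ := exists_descent hne
    have hl := descent_index_le hσ hi
    have hc := card_inversions_of_descent i hi
    have hm := mul_mem_young (simpleRefl_mem_young i hl) hσ
    rw [← simpleRefl_mul_cancel i σ]
    refine step i hl _ hm ?_ (ih _ hm (by omega))
    rwa [simpleRefl_mul_inv_apply, simpleRefl_mul_inv_apply, simpleRefl_lo, simpleRefl_hi]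

/-- The factor `(x_i - t x_j)/(x_i - x_j)`. -/
def kernelFactor (i j : Fin n) : Rat n := (xr i - tr n * xr j) / (xr i - xr j)

theorem act_kernelFactor (w : Perm (Fin n)) (i j : Fin n) :
    act w (kernelFactor i j) = kernelFactor (w i) (w j) := by
  simp only [kernelFactor, map_div₀, map_sub, map_mul, act_xr, act_tr]

/-- The product `∏_{l ≤ i < j} (x_i - t x_j)/(x_i - x_j)`. -/
def kernel (l n : ℕ) : Rat n := ∏ i ∈ tail l n, ∏ j ∈ Finset.Ioi i, kernelFactor i j

/-- The symmetrizer `F ↦ ∑_w w(F ∏_{l ≤ i < j} (x_i - t x_j)/(x_i - x_j))`. -/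
def symm (l : ℕ) (F : Rat n) : Rat n := ∑ w ∈ young l n, act w (F * kernel l n)

/-- s_i permutes the ordered pairs l ≤ a < b other than (i, i+1), so only one factor of the kernel
fails to be invariant. -/
theorem exists_kernel_eq {l : ℕ} (i : SimpleIndex n) (h : l ≤ i.1) :
    ∃ G : Rat n, kernel l n = kernelFactor i.lo i.hi * G ∧ act (simpleRefl i) G = G := by
  classical
  let pairs : Finset (Fin n × Fin n) := {p | l ≤ (p.1 : ℕ) ∧ p.1 < p.2}
  have hp : ∀ p, p ∈ pairs ↔ l ≤ (p.1 : ℕ) ∧ p.1 < p.2 := fun p => by simp [pairs]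
  have hs := simpleRefl_mem_young i h
  have hl : ∀ a : Fin n, l ≤ (simpleRefl i a : ℕ) ↔ l ≤ (a : ℕ) := by
    intro a
    rw [← mem_tail, ← mem_tail]
    refine ⟨fun ha => ?_, apply_mem_tail hs⟩
    rw [← simpleRefl_apply_self i a]
    exact apply_mem_tail hs ha
  refine ⟨∏ p ∈ pairs.erase (i.lo, i.hi), kernelFactor p.1 p.2, ?_, ?_⟩
  · rw [Finset.mul_prod_erase pairs (fun p => kernelFactor p.1 p.2) (a := (i.lo, i.hi))
      ((hp _).2 ⟨h, i.lo_lt_hi⟩), kernel]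
    exact (Finset.prod_finset_product' pairs (tail l n) Finset.Ioi (fun p => by
      rw [hp, mem_tail, Finset.mem_Ioi])).symm
  · have hmem : ∀ p ∈ pairs.erase (i.lo, i.hi),
        (simpleRefl i p.1, simpleRefl i p.2) ∈ pairs.erase (i.lo, i.hi) := by
      rintro ⟨a, b⟩ hab
      rw [Finset.mem_erase, hp] at hab ⊢
      obtain ⟨hne, h1, h2⟩ := hab
      have hn1 : ¬ (a = i.lo ∧ b = i.hi) := by simpa using hne
      have hn2 : ¬ (a = i.hi ∧ b = i.lo) := by
        rintro ⟨rfl, rfl⟩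
        exact lt_asymm h2 i.lo_lt_hi
      refine ⟨fun e => hn2 ?_, (hl a).2 h1, (simpleRefl_lt_iff i hn1 hn2).2 h2⟩
      rw [Prod.mk.injEq] at e
      exact ⟨by rw [← simpleRefl_lo, ← e.1, simpleRefl_apply_self],
        by rw [← simpleRefl_hi, ← e.2, simpleRefl_apply_self]⟩
    rw [map_prod]
    refine Finset.prod_nbij' (fun p => (simpleRefl i p.1, simpleRefl i p.2))
      (fun p => (simpleRefl i p.1, simpleRefl i p.2)) hmem hmem ?_ ?_ ?_
    · intro p _
      simp only [simpleRefl_apply_self]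
    · intro p _
      simp only [simpleRefl_apply_self]
    · intro p _
      exact act_kernelFactor _ _ _

/-- Write x, y for the two variables, and pair w with w s_i in the second term of T_i F. Its
coefficient and the non-invariant kernel factor then exchange roles, and the total coefficient of F
times the kernel is ((1-t)x + (tx - y))/(x - y) = 1. -/
theorem symm_ratT {l : ℕ} (i : SimpleIndex n) (h : l ≤ i.1) (F : Rat n) :
    symm l (ratT i F) = symm l F := by
  obtain ⟨G, hG, hGs⟩ := exists_kernel_eq i h
  have hxy := xr_sub_ne_zero i.lo_lt_hi.ne
  have hyx := xr_sub_ne_zero i.lo_lt_hi.ne'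
  simp only [symm, ratT, add_mul, map_add, Finset.sum_add_distrib]
  rw [← sum_young_mul_right (simpleRefl_mem_young i h) fun w => act w
    ((tr n * xr i.lo - xr i.hi) / (xr i.lo - xr i.hi) * act (simpleRefl i) F * kernel l n),
    ← Finset.sum_add_distrib]
  refine Finset.sum_congr rfl fun w _ => ?_
  rw [act_mul, ← map_add, hG]
  congr 1
  simp only [map_mul, map_div₀, map_sub, act_tr, act_xr, simpleRefl_lo,
    simpleRefl_hi, act_simpleRefl_self, hGs, kernelFactor]
  field_simp
  ring

theorem symm_add (l : ℕ) (F G : Rat n) : symm l (F + G) = symm l F + symm l G := by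
  simp only [symm, add_mul, map_add, Finset.sum_add_distrib]

theorem symm_smul (l : ℕ) (c : K) (F : Rat n) : symm l (c • F) = c • symm l F := by
  simp only [symm, smul_mul_assoc, act_smul, Finset.smul_sum]

theorem symm_sum {ι : Type*} (s : Finset ι) (l : ℕ) (F : ι → Rat n) :
    symm l (∑ i ∈ s, F i) = ∑ i ∈ s, symm l (F i) := by
  simp only [symm, Finset.sum_mul, map_sum]
  exact Finset.sum_comm

theorem symm_mul_of_invariant {l : ℕ} {G : Rat n} (hG : ∀ w ∈ young l n, act w G = G) (F : Rat n) :
    symm l (G * F) = G * symm l F := by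
  rw [symm, symm, Finset.mul_sum]
  refine Finset.sum_congr rfl fun w hw => ?_
  rw [mul_assoc, map_mul, hG w hw]

theorem act_of_simpleRefl_invariant {l : ℕ} {G : Rat n}
    (hG : ∀ i : SimpleIndex n, l ≤ i.1 → act (simpleRefl i) G = G) (w : Perm (Fin n))
    (hw : w ∈ young l n) : act w G = G := by
  refine young_induction (P := fun w => act w G = G) (act_one G) ?_ w hw
  intro i hi σ _ _ ih
  rw [act_mul, ih, hG i hi]

theorem symm_heckeT {l : ℕ} {σ : Perm (Fin n)} (hσ : σ ∈ young l n) (f : Pol n) :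
    symm l (toRat n (heckeT σ f)) = symm l (toRat n f) := by
  refine young_induction (P := fun σ => symm l (toRat n (heckeT σ f)) = symm l (toRat n f))
    (by rw [heckeT_one]) ?_ σ hσ
  intro i hi σ _ h ih
  rw [heckeT_simpleRefl_mul i h, toRat_demazureLusztig, symm_ratT i hi, ih]

/-- The sum that defines the partial idempotent is symmetric. -/
theorem act_sum_heckeT {l : ℕ} (N : ℤ) (f : Pol n) (i : SimpleIndex n) (hi : l ≤ i.1) :
    act (simpleRefl i) (∑ σ ∈ young l n, t ^ (N - (len σ : ℤ)) • toRat n (heckeT σ f)) =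
      ∑ σ ∈ young l n, t ^ (N - (len σ : ℤ)) • toRat n (heckeT σ f) := by
  set g : Perm (Fin n) → Rat n := fun σ => t ^ (N - (len σ : ℤ)) • toRat n (heckeT σ f) with hg
  have hxy := xr_sub_ne_zero i.lo_lt_hi.ne
  have hyx := xr_sub_ne_zero i.lo_lt_hi.ne'
  -- The pair contributes a scalar multiple of tH + T_i H with H = T_σ f. This equals κH + s_i(κH)
  -- with κ the kernel factor at `i`, hence is invariant.
  have asc : ∀ σ : Perm (Fin n), σ⁻¹ i.lo < σ⁻¹ i.hi →
      act (simpleRefl i) (g σ + g (simpleRefl i * σ)) = g σ + g (simpleRefl i * σ) := by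
    intro σ h
    simp only [hg, len_simpleRefl_mul i h, heckeT_simpleRefl_mul i h, toRat_demazureLusztig]
    generalize toRat n (heckeT σ f) = H
    have e : t ^ (N - (len σ : ℤ)) • H = t ^ (N - ((len σ + 1 : ℕ) : ℤ)) • (tr n * H) := by
      rw [tr, ← Algebra.smul_def, smul_smul, ← zpow_add_one₀ t_ne_zero]
      congr 2
      push_cast
      ring
    rw [e, ← smul_add, act_smul]
    congr 1
    simp only [ratT, map_add, map_mul, map_div₀, map_sub, map_one, act_tr, act_xr, simpleRefl_lo,
      simpleRefl_hi, act_simpleRefl_self]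
    field_simp
    ring
  have hpair : ∀ σ : Perm (Fin n),
      act (simpleRefl i) (g σ + g (simpleRefl i * σ)) = g σ + g (simpleRefl i * σ) := by
    intro σ
    rcases ascent_or_descent i σ with h | h
    · exact asc σ h
    · have := asc (simpleRefl i * σ) (by
        rwa [simpleRefl_mul_inv_apply, simpleRefl_mul_inv_apply, simpleRefl_lo, simpleRefl_hi])
      rwa [simpleRefl_mul_cancel, add_comm] at this
  -- Summing over all σ counts each pair {σ, s_i σ} twice, which avoids choosing representatives;
  -- the 2 is cancelled at the end.
  have h2 : (2 : Rat n) * ∑ σ ∈ young l n, g σ =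
      ∑ σ ∈ young l n, (g σ + g (simpleRefl i * σ)) := by
    rw [Finset.sum_add_distrib, sum_young_mul_left (simpleRefl_mem_young i hi), two_mul]
  have h3 : act (simpleRefl i) ((2 : Rat n) * ∑ σ ∈ young l n, g σ) =
      (2 : Rat n) * ∑ σ ∈ young l n, g σ := by
    rw [h2, map_sum]
    exact Finset.sum_congr rfl fun σ _ => hpair σ
  rw [map_mul, map_ofNat] at h3
  exact mul_left_cancel₀ two_ne_zero h3

theorem toRat_smul (c : K) (f : Pol n) : toRat n (c • f) = c • toRat n f := map_smul _ _ _

/-- The partial idempotent is the normalized symmetrizer. -/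
theorem toRat_partialIdempotent_of_symm_one {l : ℕ} (hl : l ≤ n)
    (h1 : symm l (1 : Rat n) = algebraMap K (Rat n) (tFactorial (n - l))) (f : Pol n) :
    toRat n (partialIdempotent l n f) = (tFactorial (n - l))⁻¹ • symm l (toRat n f) := by
  have hne := tFactorial_ne_zero (n - l)
  rw [partialIdempotent, toRat_smul]
  congr 1
  simp only [map_sum, toRat_smul]
  set S := ∑ σ ∈ young l n, t ^ (((n - l).choose 2 : ℤ) - (len σ : ℤ)) • toRat n (heckeT σ f)
    with hS
  have hinv := act_of_simpleRefl_invariant (G := S) (fun i hi => act_sum_heckeT _ f i hi)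
  -- `symm l S` is evaluated twice: S is invariant, so it factors out; and each T_σ is absorbed,
  -- leaving the Poincaré polynomial. Comparison gives S = `symm l (toRat n f)`.
  have e1 : symm l S = tFactorial (n - l) • S := by
    rw [← mul_one S, symm_mul_of_invariant hinv, h1, mul_one, mul_comm, ← Algebra.smul_def]
  have e2 : symm l S = tFactorial (n - l) • symm l (toRat n f) := by
    rw [← sum_young_t_pow_len hl, Finset.sum_smul, hS, symm_sum]
    refine Finset.sum_congr rfl fun σ hσ => ?_
    rw [symm_smul, symm_heckeT hσ]
  exact smul_right_injective _ hne (e1.symm.trans e2)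

/-- The product `∏_{j ≠ p} (x_p - t x_j)/(x_p - x_j)` over the positions `j ≥ l`. -/
def residue (l : ℕ) (p : Fin n) : Rat n := ∏ j ∈ (tail l n).erase p, kernelFactor p j

theorem act_residue {l : ℕ} {w : Perm (Fin n)} (hw : w ∈ young l n) (p : Fin n) :
    act w (residue l p) = residue l (w p) := by
  rw [residue, residue, map_prod]
  refine Finset.prod_nbij' (fun j => w j) (fun j => w⁻¹ j) ?_ ?_
    (fun j _ => perm_inv_apply w j) (fun j _ => perm_apply_inv w j) ?_
  · intro j hj
    rw [Finset.mem_erase] at hj ⊢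
    exact ⟨fun e => hj.1 (w.injective e), apply_mem_tail hw hj.2⟩
  · intro j hj
    rw [Finset.mem_erase] at hj ⊢
    refine ⟨fun e => hj.1 ?_, apply_mem_tail (inv_mem_young hw) hj.2⟩
    rw [← e, perm_apply_inv]
  · intro j _
    exact act_kernelFactor _ _ _

theorem kernel_eq_residue_mul {l : ℕ} (h : l < n) :
    kernel l n = residue l ⟨l, h⟩ * kernel (l + 1) n := by
  rw [kernel, tail_eq_insert h, Finset.prod_insert (notMem_tail_succ h), kernel, residue,
    tail_eq_insert h, Finset.erase_insert (notMem_tail_succ h)]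
  congr 1
  refine Finset.prod_congr ?_ fun _ _ => rfl
  ext j
  simp [mem_tail, Fin.lt_def]

/-! ### Coset recursion and nesting of symmetrizers -/

theorem mem_tail_self {l : ℕ} (h : l < n) : (⟨l, h⟩ : Fin n) ∈ tail l n := by simp [mem_tail]

/-- The kernel at l is the residue at position l times the kernel at l+1. That residue is fixed by
the smaller subgroup, and the transposition of l and p carries it to the residue at p. -/
theorem symm_eq_sum {l : ℕ} (h : l < n) (F : Rat n) :
    symm l F = ∑ p ∈ tail l n,
      residue l p * act (swap ⟨l, h⟩ p) (symm (l + 1) F) := by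
  have hs : ∀ p ∈ tail l n, swap (⟨l, h⟩ : Fin n) p ∈ young l n :=
    fun p hp => swap_mem_young (mem_tail_self h) hp
  rw [symm, sum_young h (fun p => swap ⟨l, h⟩ p) fun p hp => ⟨hs p hp, swap_apply_left _ _⟩]
  refine Finset.sum_congr rfl fun p hp => ?_
  rw [symm, map_sum, Finset.mul_sum]
  refine Finset.sum_congr rfl fun v hv => ?_
  rw [act_mul, kernel_eq_residue_mul h, mul_left_comm, map_mul, map_mul,
    act_residue (young_mono l.le_succ hv), mem_young.1 hv _ (by simp), act_residue (hs p hp),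
    swap_apply_left]

theorem xr_invariant {l : ℕ} {i : Fin n} (hi : (i : ℕ) < l) (w : Perm (Fin n))
    (hw : w ∈ young l n) : act w (xr i) = xr i := by
  rw [act_xr, mem_young.1 hw i hi]

theorem symm_of_invariant {l : ℕ} {G : Rat n} (hG : ∀ w ∈ young l n, act w G = G) :
    symm l G = G * symm l 1 := by
  rw [← symm_mul_of_invariant hG, mul_one]

/-- The kernel at k is E times the kernel at l, with E fixed by the smaller group. Reindexing w ↦
wv, v ↦ v⁻¹ in the double sum moves the inner symmetrization from F to the kernel: a
self-adjointness. -/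
theorem symm_symm {k l : ℕ} (h : k ≤ l) (F : Rat n) :
    symm k (symm l F) = symm k (F * symm l 1) := by
  have hE : ∃ E : Rat n, kernel k n = E * kernel l n ∧ ∀ v ∈ young l n, act v E = E := by
    induction l, h using Nat.le_induction with
    | base => exact ⟨1, (one_mul _).symm, fun v _ => map_one _⟩
    | succ l hkl ih =>
      obtain ⟨E, hE, hinv⟩ := ih
      rcases Nat.lt_or_ge l n with hl | hl
      · refine ⟨E * residue l ⟨l, hl⟩, by rw [hE, kernel_eq_residue_mul hl, mul_assoc],
          fun v hv => ?_⟩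
        rw [map_mul, hinv v (young_mono l.le_succ hv), act_residue (young_mono l.le_succ hv),
          mem_young.1 hv _ (by simp)]
      · refine ⟨E, ?_, fun v hv => hinv v (young_mono l.le_succ hv)⟩
        rw [hE, kernel, kernel, tail_eq_empty hl, tail_eq_empty (by omega)]
  obtain ⟨E, hE, hinv⟩ := hE
  have e1 : symm k (symm l F) = ∑ w ∈ young k n, ∑ v ∈ young l n,
      act w (act v (F * kernel l n) * (E * kernel l n)) := by
    rw [symm]
    refine Finset.sum_congr rfl fun w _ => ?_
    rw [hE, symm, Finset.sum_mul, map_sum]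
  have e2 : symm k (F * symm l 1) = ∑ w ∈ young k n, ∑ v ∈ young l n,
      act w (F * act v (kernel l n) * (E * kernel l n)) := by
    rw [symm]
    refine Finset.sum_congr rfl fun w _ => ?_
    rw [hE, symm, Finset.mul_sum, Finset.sum_mul, map_sum]
    simp only [one_mul]
  rw [e1, e2, Finset.sum_comm, Finset.sum_comm (s := young k n)]
  have inv_sum : ∀ G : Perm (Fin n) → Rat n,
      ∑ v ∈ young l n, G v⁻¹ = ∑ v ∈ young l n, G v := fun G =>
    Finset.sum_nbij' (fun v => v⁻¹) (fun v => v⁻¹) (fun _ hv => inv_mem_young hv)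
      (fun _ hv => inv_mem_young hv) (by simp) (by simp) (by simp)
  rw [← inv_sum]
  refine Finset.sum_congr rfl fun v hv => ?_
  rw [← sum_young_mul_right (young_mono h hv)]
  refine Finset.sum_congr rfl fun w _ => ?_
  rw [act_mul]
  congr 1
  have : act v (act v⁻¹ (F * kernel l n)) = F * kernel l n := by
    rw [← act_mul, mul_inv_cancel, act_one]
  rw [map_mul, this, map_mul, hinv v hv]
  ring

end Symmetrizer

/-! ### Partial fractions and the generating function of `h_N[(1-t)X]` -/

section PartialFractions

variable {F ι : Type*} [Field F] [DecidableEq ι]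

/-- The Lagrange interpolation of `∏_j (y - τ x_j)` at `0` and the `x_j`. -/
theorem prod_sub_mul_eq (τ : F) (s : Finset ι) (x : ι → F) (hx : Set.InjOn x s)
    (h0 : ∀ i ∈ s, x i ≠ 0) (y : F) :
    ∏ j ∈ s, (y - τ * x j) = τ ^ s.card * ∏ j ∈ s, (y - x j) +
      (1 - τ) * y * ∑ p ∈ s, (∏ j ∈ s.erase p, (x p - τ * x j) / (x p - x j)) *
        ∏ j ∈ s.erase p, (y - x j) := by
  classical
  let P : Polynomial F := ∏ j ∈ s, (Polynomial.X - Polynomial.C (τ * x j))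
  let D : ι → F := fun p => ∏ j ∈ s.erase p, (x p - τ * x j) / (x p - x j)
  let Q : Polynomial F := Polynomial.C (τ ^ s.card) * ∏ j ∈ s, (Polynomial.X - Polynomial.C (x j)) +
    Polynomial.C (1 - τ) * Polynomial.X * ∑ p ∈ s, Polynomial.C (D p) *
      ∏ j ∈ s.erase p, (Polynomial.X - Polynomial.C (x j))
  have hdeg : ∀ (u : Finset ι) (z : ι → F),
      (∏ j ∈ u, (Polynomial.X - Polynomial.C (z j))).natDegree = u.card := by
    intro u z
    rw [Polynomial.natDegree_prod_of_monic _ _ fun j _ => Polynomial.monic_X_sub_C _]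
    simp
  have hPQ : P = Q := by
    have hcard : (insert 0 (s.image x)).card = s.card + 1 := by
      rw [Finset.card_insert_of_notMem, Finset.card_image_of_injOn hx]
      rw [Finset.mem_image]
      rintro ⟨i, hi, e⟩
      exact h0 i hi e
    refine Polynomial.eq_of_degrees_lt_of_eval_finset_eq (insert 0 (s.image x)) ?_ ?_ ?_
    · rw [hcard]
      refine Polynomial.degree_le_natDegree.trans_lt ?_
      rw [hdeg]
      exact_mod_cast s.card.lt_succ_self
    · rw [hcard]
      have : Q.natDegree ≤ s.card := by
        refine Polynomial.natDegree_add_le_of_degree_le ?_ ?_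
        · exact (Polynomial.natDegree_C_mul_le _ _).trans (hdeg _ _).le
        · rw [Finset.mul_sum]
          refine Polynomial.natDegree_sum_le_of_forall_le _ _ fun p hp => ?_
          rw [← Finset.card_erase_add_one hp, mul_assoc, add_comm]
          refine (Polynomial.natDegree_C_mul_le _ _).trans (Polynomial.natDegree_mul_le_of_le
            Polynomial.natDegree_X_le ((Polynomial.natDegree_C_mul_le _ _).trans (hdeg _ _).le))
      refine Polynomial.degree_le_natDegree.trans_lt ?_
      exact_mod_cast Nat.lt_succ_of_le this
    · intro z hz
      rw [Finset.mem_insert, Finset.mem_image] at hz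
      rcases hz with rfl | ⟨p, hp, rfl⟩
      · simp [P, Q, Polynomial.eval_prod, Finset.prod_neg, Finset.prod_mul_distrib]
        ring
      · have hz : ∀ q ∈ s, q ≠ p → ∏ j ∈ s.erase q, (x p - x j) = 0 := fun q _ hqp =>
          Finset.prod_eq_zero (Finset.mem_erase.2 ⟨hqp.symm, hp⟩) (sub_self _)
        have hne : ∏ j ∈ s.erase p, (x p - x j) ≠ 0 := by
          rw [Finset.prod_ne_zero_iff]
          intro j hj
          rw [Finset.mem_erase] at hj
          exact sub_ne_zero.2 fun e => hj.1 (hx hj.2 hp e.symm)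
        simp only [P, Q, D, Polynomial.eval_prod, Polynomial.eval_add, Polynomial.eval_mul,
          Polynomial.eval_sub, Polynomial.eval_X, Polynomial.eval_C, Polynomial.eval_finsetSum]
        rw [Finset.sum_eq_single_of_mem p hp fun q hq hqp => by rw [hz q hq hqp, mul_zero],
          Finset.prod_eq_zero (f := fun j => x p - x j) hp (sub_self _), Finset.prod_div_distrib,
          div_mul_cancel₀ _ hne, ← Finset.mul_prod_erase s _ hp]
        ring
  have := congrArg (Polynomial.eval y) hPQ
  simpa only [P, Q, D, Polynomial.eval_prod, Polynomial.eval_add, Polynomial.eval_mul,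
    Polynomial.eval_sub, Polynomial.eval_X, Polynomial.eval_C, Polynomial.eval_finsetSum] using this

/-- The interpolation identity at y = z⁻¹, multiplied by z^|s|; the extra factor y in the sum makes
up for the factor missing from each product. The substitution is valid for the infinitely many z ≠
0, which suffices for polynomials. -/
theorem prod_one_sub_mul_X_eq [CharZero F] (τ : F) (s : Finset ι) (x : ι → F) (hx : Set.InjOn x s)
    (h0 : ∀ i ∈ s, x i ≠ 0) :
    ∏ j ∈ s, (1 - Polynomial.C (τ * x j) * Polynomial.X) =
      Polynomial.C (τ ^ s.card) * ∏ j ∈ s, (1 - Polynomial.C (x j) * Polynomial.X) +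
      Polynomial.C (1 - τ) * ∑ p ∈ s,
        Polynomial.C (∏ j ∈ s.erase p, (x p - τ * x j) / (x p - x j)) *
        ∏ j ∈ s.erase p, (1 - Polynomial.C (x j) * Polynomial.X) := by
  refine Polynomial.eq_of_infinite_eval_eq _ _ (Set.Infinite.mono (s := {0}ᶜ) ?_
    (Set.finite_singleton (0 : F)).infinite_compl)
  intro z hz
  have hz : z ≠ 0 := hz
  have key := prod_sub_mul_eq τ s x hx h0 z⁻¹
  have hfac : ∀ a : F, z⁻¹ - a = z⁻¹ * (1 - a * z) := fun a => by field_simp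
  simp only [Set.mem_ofPred_eq, Polynomial.eval_prod, Polynomial.eval_add, Polynomial.eval_mul,
    Polynomial.eval_sub, Polynomial.eval_X, Polynomial.eval_C, Polynomial.eval_finsetSum,
    Polynomial.eval_one]
  simp only [hfac, Finset.prod_mul_distrib (f := fun _ => z⁻¹), Finset.prod_const] at key
  have e : ∀ p ∈ s, z⁻¹ ^ (s.erase p).card = z⁻¹ ^ s.card * z := by
    intro p hp
    rw [← Finset.card_erase_add_one hp, pow_succ, mul_assoc, inv_mul_cancel₀ hz, mul_one]
  refine mul_left_cancel₀ (pow_ne_zero s.card (inv_ne_zero hz)) (key.trans ?_)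
  rw [mul_add, Finset.mul_sum, Finset.mul_sum, Finset.mul_sum]
  congr 1
  · ring
  refine Finset.sum_congr rfl fun p hp => ?_
  rw [e p hp]
  field_simp

/-- The coefficients of `∏_j (1 - τ x_j z)/(1 - x_j z)`, by partial fractions. -/
def cauchyCoeff (τ : F) (s : Finset ι) (x : ι → F) (N : ℕ) : F :=
  (1 - τ) * ∑ p ∈ s, (∏ j ∈ s.erase p, (x p - τ * x j) / (x p - x j)) * x p ^ N +
    if N = 0 then τ ^ s.card else 0

theorem geom_mul (a : F) :
    PowerSeries.mk (fun N => a ^ N) * (1 - PowerSeries.C a * PowerSeries.X) = 1 := by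
  ext N
  rw [mul_sub, mul_one, mul_left_comm, map_sub, PowerSeries.coeff_C_mul, PowerSeries.coeff_one]
  cases N with
  | zero => simp
  | succ N => simp [PowerSeries.coeff_succ_mul_X, pow_succ']

theorem mk_cauchyCoeff_mul [CharZero F] (τ : F) (s : Finset ι) (x : ι → F) (hx : Set.InjOn x s)
    (h0 : ∀ i ∈ s, x i ≠ 0) :
    PowerSeries.mk (cauchyCoeff τ s x) *
        ∏ j ∈ s, (1 - PowerSeries.C (x j) * PowerSeries.X) =
      ∏ j ∈ s, (1 - PowerSeries.C (τ * x j) * PowerSeries.X) := by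
  have key := congrArg (Polynomial.coeToPowerSeries.ringHom (R := F))
    (prod_one_sub_mul_X_eq τ s x hx h0)
  simp only [map_prod, map_sub, map_one, map_mul, map_add, map_sum,
    Polynomial.coeToPowerSeries.ringHom_apply, Polynomial.coe_C, Polynomial.coe_X] at key
  simp only [map_mul]
  rw [key]
  have hQ : PowerSeries.mk (cauchyCoeff τ s x) = PowerSeries.C (τ ^ s.card) +
      PowerSeries.C (1 - τ) * ∑ p ∈ s,
        PowerSeries.C (∏ j ∈ s.erase p, (x p - τ * x j) / (x p - x j)) *
        PowerSeries.mk (fun N => x p ^ N) := by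
    ext N
    simp only [PowerSeries.coeff_mk, cauchyCoeff, map_add, PowerSeries.coeff_C_mul, map_sum,
      PowerSeries.coeff_C]
    rw [add_comm]
  rw [hQ, add_mul, mul_assoc, Finset.sum_mul]
  simp only [map_pow, map_sub, map_one, map_prod]
  congr 2
  refine Finset.sum_congr rfl fun p hp => ?_
  rw [← Finset.mul_prod_erase s _ hp, mul_assoc, ← mul_assoc (PowerSeries.mk _), geom_mul, one_mul]

/-- The logarithmic derivative of ∏ (1 - x_j z) is minus the generating series of power sums,
written without division. -/
theorem derivative_prod_one_sub (s : Finset ι) (x : ι → F) :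
    PowerSeries.derivative F (∏ j ∈ s, (1 - PowerSeries.C (x j) * PowerSeries.X)) =
      -((∏ j ∈ s, (1 - PowerSeries.C (x j) * PowerSeries.X)) *
        PowerSeries.mk fun N => ∑ j ∈ s, x j ^ (N + 1)) := by
  induction s using Finset.induction_on with
  | empty =>
    have : (PowerSeries.mk fun _ => 0 : PowerSeries F) = 0 := by ext; simp
    simp [this]
  | insert a s ha ih =>
    have hd : PowerSeries.derivative F (1 - PowerSeries.C (x a) * PowerSeries.X) =
        -PowerSeries.C (x a) := by
      rw [map_sub, Derivation.leibniz]
      simp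
    have hm : (PowerSeries.mk fun N => ∑ j ∈ insert a s, x j ^ (N + 1)) =
        PowerSeries.C (x a) * PowerSeries.mk (fun N => x a ^ N) +
          PowerSeries.mk fun N => ∑ j ∈ s, x j ^ (N + 1) := by
      ext N
      simp [Finset.sum_insert ha, pow_succ']
    rw [Finset.prod_insert ha, Derivation.leibniz, ih, hd, hm, smul_eq_mul, smul_eq_mul]
    have g := geom_mul (x a)
    set G := PowerSeries.mk fun N => x a ^ N
    linear_combination (PowerSeries.C (x a) *
      ∏ j ∈ s, (1 - PowerSeries.C (x j) * PowerSeries.X)) * g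

theorem cauchyCoeff_zero [CharZero F] (τ : F) (s : Finset ι) (x : ι → F) (hx : Set.InjOn x s)
    (h0 : ∀ i ∈ s, x i ≠ 0) : cauchyCoeff τ s x 0 = 1 := by
  have key := congrArg PowerSeries.constantCoeff (mk_cauchyCoeff_mul τ s x hx h0)
  simpa [map_prod] using key

/-- Newton's recursion for the coefficients of `∏_j (1 - τ x_j z)/(1 - x_j z)`. -/
theorem cauchyCoeff_succ [CharZero F] (τ : F) (s : Finset ι) (x : ι → F) (hx : Set.InjOn x s)
    (h0 : ∀ i ∈ s, x i ≠ 0) (N : ℕ) :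
    ((N : F) + 1) * cauchyCoeff τ s x (N + 1) = ∑ r ∈ Finset.range (N + 1),
      (1 - τ ^ (r + 1)) * (∑ j ∈ s, x j ^ (r + 1)) * cauchyCoeff τ s x (N - r) := by
  have key := mk_cauchyCoeff_mul τ s x hx h0
  have hA := derivative_prod_one_sub s x
  have hB := derivative_prod_one_sub s fun j => τ * x j
  set A := ∏ j ∈ s, (1 - PowerSeries.C (x j) * PowerSeries.X) with hAdef
  set Q := PowerSeries.mk (cauchyCoeff τ s x)
  set P := PowerSeries.mk fun N => ∑ j ∈ s, x j ^ (N + 1)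
  set P' := PowerSeries.mk fun N => ∑ j ∈ s, (τ * x j) ^ (N + 1)
  rw [← key, Derivation.leibniz, hA, smul_eq_mul, smul_eq_mul] at hB
  have hA0 : A ≠ 0 := by
    rw [hAdef, Finset.prod_ne_zero_iff]
    intro j _ h
    have := congrArg PowerSeries.constantCoeff h
    simp at this
  -- Q is the quotient of two such products, so its logarithmic derivative is a difference of power
  -- sum series, with coefficients (1 - τ^r) p_r.
  have hQ : PowerSeries.derivative F Q = (P - P') * Q := by
    apply mul_left_cancel₀ hA0
    linear_combination hB
  have := congrArg (PowerSeries.coeff N) hQ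
  rw [PowerSeries.coeff_derivative, PowerSeries.coeff_mul,
    Finset.Nat.sum_antidiagonal_eq_sum_range_succ_mk] at this
  simp only [Q, P, P', PowerSeries.coeff_mk, map_sub] at this
  rw [mul_comm, this]
  refine Finset.sum_congr rfl fun r _ => ?_
  congr 1
  simp only [mul_pow, ← Finset.mul_sum]
  ring

end PartialFractions

/-! ### Vertex operators and the symmetrizer -/

section Vertex

open Equiv

variable {n : ℕ}

/-- The evaluation of an element of `𝒫_∞⁺` in `n` variables, as a rational function. -/
def evRat (n : ℕ) : PInf →ₐ[K] Rat n :=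
  (toRat n).comp ((Pi.evalAlgHom K Pol n).comp PInf.val)

theorem evRat_apply (F : PInf) : evRat n F = toRat n (F.1 n) := rfl

/-- The evaluation `G ↦ G[x_{l+1} + ⋯ + x_n]`. -/
def evSym (l n : ℕ) : SymFun →ₐ[K] Rat n := (evRat n).comp (inAlphabet l)

theorem evSym_X (l : ℕ) (r : ℕ+) :
    evSym l n (MvPolynomial.X r) = ∑ j ∈ tail l n, xr j ^ (r : ℕ) := by
  rw [evSym, AlgHom.comp_apply, inAlphabet, MvPolynomial.aeval_X, evRat_apply, tail,
    Finset.sum_filter]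
  simp only [pInf, map_sum]
  refine Finset.sum_congr rfl fun j _ => ?_
  split_ifs
  · rw [map_pow, xr]
  · exact map_zero _

theorem act_evSym {l : ℕ} {w : Perm (Fin n)} (hw : w ∈ young l n) (G : SymFun) :
    act w (evSym l n G) = evSym l n G := by
  have : (act w).comp (evSym l n) = evSym l n := by
    refine MvPolynomial.algHom_ext fun r => ?_
    rw [AlgHom.comp_apply, evSym_X, map_sum]
    refine Finset.sum_nbij' (fun j => w j) (fun j => w⁻¹ j) (fun _ => apply_mem_tail hw)
      (fun _ => apply_mem_tail (inv_mem_young hw)) (fun j _ => perm_inv_apply w j)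
      (fun j _ => perm_apply_inv w j) fun j _ => ?_
    rw [map_pow, act_xr]
  exact congrArg (fun φ => φ G) this

/-- Both sides satisfy Newton's recursion with power sums (1 - t^r) p_r. This turns h_N[(1-t)X] into
a sum over residues, the shape in which symmetrizers appear. -/
theorem evSym_hSym (l N : ℕ) :
    evSym l n (plethOneSubT (hSym N)) = cauchyCoeff (tr n) (tail l n) xr N := by
  have hx : Set.InjOn (xr (n := n)) (tail l n) := xr_injective.injOn
  have h0 : ∀ i ∈ tail l n, xr i ≠ 0 := fun i _ => xr_ne_zero i
  induction N using Nat.strong_induction_on with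
  | _ N ih =>
    cases N with
    | zero => rw [hSym, map_one, map_one, cauchyCoeff_zero _ _ _ hx h0]
    | succ N =>
      have hN : ((N : Rat n) + 1) ≠ 0 := by exact_mod_cast N.succ_ne_zero
      apply mul_left_cancel₀ hN
      rw [cauchyCoeff_succ _ _ _ hx h0, hSym, map_mul, map_mul]
      have hC : evSym l n (plethOneSubT (MvPolynomial.C ((N + 1 : K)⁻¹))) =
          ((N : Rat n) + 1)⁻¹ := by
        refine (((evSym l n).comp plethOneSubT).commutes _).trans ?_
        rw [map_inv₀, map_add, map_natCast, map_one]
      rw [hC, ← mul_assoc, mul_inv_cancel₀ hN, one_mul, map_sum, map_sum,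
        ← Fin.sum_univ_eq_sum_range (fun r => (1 - tr n ^ (r + 1)) *
          (∑ j ∈ tail l n, xr j ^ (r + 1)) * cauchyCoeff (tr n) (tail l n) xr (N - r))]
      refine Finset.sum_congr rfl fun r _ => ?_
      rw [map_mul, map_mul, ih (N - r) (by omega), plethOneSubT, MvPolynomial.aeval_X, map_mul,
        evSym_X]
      congr 2
      refine ((evSym l n).commutes _).trans ?_
      rw [map_sub, map_one, map_pow, tr]
      rfl

/-- The constant term of the partial fraction expansion, which is 1. It drives the recursion for
`symm_one`. -/
theorem sum_residue {l : ℕ} : (1 - tr n) * ∑ p ∈ tail l n, residue l p = 1 - tr n ^ (n - l) := by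
  have h := cauchyCoeff_zero (tr n) (tail l n) xr xr_injective.injOn fun i _ => xr_ne_zero i
  simp only [cauchyCoeff, pow_zero, mul_one, if_true, card_tail] at h
  exact eq_sub_of_add_eq h

theorem symm_one {l : ℕ} (hl : l ≤ n) :
    symm l (1 : Rat n) = algebraMap K (Rat n) (tFactorial (n - l)) := by
  induction hm : n - l generalizing l with
  | zero =>
    rw [symm, young_eq_one (by omega), Finset.sum_singleton, act_one, kernel,
      tail_eq_empty (by omega), tFactorial_zero]
    simp
  | succ m ih =>
    have h : l < n := by omega
    have h1 : (1 - tr n) ≠ 0 := by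
      rw [tr, ← map_one (algebraMap K (Rat n)), ← map_sub]
      exact (map_ne_zero _).2 one_sub_t_ne_zero
    have hs : ∀ p ∈ tail l n, residue l p * act (swap ⟨l, h⟩ p) (symm (l + 1) (1 : Rat n)) =
        residue l p * algebraMap K (Rat n) (tFactorial m) := by
      intro p _
      rw [ih (l := l + 1) (by omega) (by omega), AlgHom.commutes]
    rw [symm_eq_sum h, Finset.sum_congr rfl hs, ← Finset.sum_mul, tFactorial_succ, map_mul,
      mul_comm]
    congr 1
    rw [map_div₀, map_sub, map_sub, map_one, map_pow, ← tr, eq_div_iff h1, mul_comm, sum_residue, hm]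

theorem toRat_partialIdempotent {l : ℕ} (hl : l ≤ n) (f : Pol n) :
    toRat n (partialIdempotent l n f) = (tFactorial (n - l))⁻¹ • symm l (toRat n f) :=
  toRat_partialIdempotent_of_symm_one hl (symm_one hl) f

/-- At z⁻¹ = x_p the alphabet X - z⁻¹ is X with the variable x_p removed. This is the alphabet of
the positions after l, with l and p exchanged. -/
theorem eval₂_shiftAlphabet {l : ℕ} (h : l < n) {p : Fin n} (hp : p ∈ tail l n) (G : SymFun) :
    (shiftAlphabet G).eval₂ (evSym l n : SymFun →+* Rat n) (xr p) =
      act (swap ⟨l, h⟩ p) (evSym (l + 1) n G) := by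
  have hs := swap_mem_young (mem_tail_self h) hp
  let φ : Polynomial SymFun →ₐ[K] Rat n :=
    { Polynomial.eval₂RingHom (evSym l n : SymFun →+* Rat n) (xr p) with
      commutes' := fun c => (Polynomial.eval₂_C _ _).trans ((evSym l n).commutes c) }
  have hφ : ∀ u, φ u = u.eval₂ (evSym l n : SymFun →+* Rat n) (xr p) := fun _ => rfl
  have : φ.comp shiftAlphabet = (act (swap ⟨l, h⟩ p)).comp (evSym (l + 1) n) := by
    refine MvPolynomial.algHom_ext fun r => ?_
    rw [AlgHom.comp_apply, AlgHom.comp_apply, shiftAlphabet, MvPolynomial.aeval_X, map_sub,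
      map_pow]
    have e1 : evSym l n (MvPolynomial.X r) = xr ⟨l, h⟩ ^ (r : ℕ) +
        evSym (l + 1) n (MvPolynomial.X r) := by
      rw [evSym_X, evSym_X, tail_eq_insert h, Finset.sum_insert (notMem_tail_succ h)]
    have e2 := act_evSym hs (MvPolynomial.X r)
    rw [e1, map_add, map_pow, act_xr, swap_apply_left] at e2
    simp only [hφ, Polynomial.eval₂_C, Polynomial.eval₂_X,
      RingHom.coe_coe, e1, ← e2]
    ring
  exact congrArg (fun φ => φ G) this

theorem coeff_zero_shiftAlphabet (G : SymFun) : (shiftAlphabet G).coeff 0 = G := by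
  rw [Polynomial.coeff_zero_eq_eval_zero]
  let φ : Polynomial SymFun →ₐ[K] SymFun :=
    { Polynomial.evalRingHom (0 : SymFun) with commutes' := fun c => Polynomial.eval_C }
  have hφ : ∀ u, φ u = u.eval 0 := fun _ => rfl
  have : φ.comp shiftAlphabet = AlgHom.id K SymFun := by
    refine MvPolynomial.algHom_ext fun r => ?_
    simp [shiftAlphabet, hφ]
  exact congrArg (fun φ => φ G) this

/-- The vertex operator `B_a`, in finitely many variables. -/
theorem evSym_jing {l : ℕ} (h : l < n) (a : ℕ) (G : SymFun) :
    evSym l n (jing a G) = (1 - tr n) * ∑ p ∈ tail l n, residue l p *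
        (xr p ^ a * act (swap ⟨l, h⟩ p) (evSym (l + 1) n G)) +
      if a = 0 then tr n ^ (n - l) * evSym l n G else 0 := by
  have e : ∀ p ∈ tail l n, act (swap ⟨l, h⟩ p) (evSym (l + 1) n G) =
      ∑ j ∈ (shiftAlphabet G).support, evSym l n ((shiftAlphabet G).coeff j) * xr p ^ j := by
    intro p hp
    rw [← eval₂_shiftAlphabet h hp, Polynomial.eval₂_eq_sum, Polynomial.sum_def]
    rfl
  rw [jing, Polynomial.sum_def, map_sum]
  simp only [map_mul, evSym_hSym, cauchyCoeff, mul_add, Finset.sum_add_distrib, card_tail]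
  congr 1
  · have e' : ∀ p ∈ tail l n, residue l p *
        (xr p ^ a * act (swap ⟨l, h⟩ p) (evSym (l + 1) n G)) = residue l p * (xr p ^ a *
        ∑ j ∈ (shiftAlphabet G).support, evSym l n ((shiftAlphabet G).coeff j) * xr p ^ j) :=
      fun p hp => by rw [e p hp]
    rw [Finset.sum_congr rfl e']
    simp only [Finset.mul_sum]
    rw [Finset.sum_comm]
    refine Finset.sum_congr rfl fun p _ => Finset.sum_congr rfl fun j _ => ?_
    change _ * (_ * (residue l p * _)) = _
    rw [pow_add]
    ring
  -- The extra constant in `cauchyCoeff` occurs only in degree 0, so only a = j = 0 contributes, and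
  -- the coefficient of z⁰ in G[X - z⁻¹] is G.
  · split_ifs with ha
    · subst ha
      rw [Finset.sum_eq_single 0]
      · rw [coeff_zero_shiftAlphabet, if_pos rfl, mul_comm]
      · intro j _ hj
        rw [if_neg (by omega), mul_zero]
      · intro h0
        rw [Polynomial.notMem_support_iff.1 h0, map_zero, zero_mul]
    · exact Finset.sum_eq_zero fun j _ => by rw [if_neg (by omega), mul_zero]

/-- The power of the first variable leaves the inner symmetrizer, and the coset recursion then gives
the residue sum in `evSym_jing`. The constant c carries the normalization of the inner symmetrizer.
-/
theorem symm_xr_pow_mul {l : ℕ} (h : l < n) (a : ℕ) (F : Rat n) (c : K) (G : SymFun)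
    (hF : symm (l + 1) F = c • evSym (l + 1) n G) :
    (1 - t) • symm l (xr ⟨l, h⟩ ^ a * F) =
      c • (evSym l n (jing a G) - if a = 0 then t ^ (n - l) • evSym l n G else 0) := by
  have e1 : symm (l + 1) (xr ⟨l, h⟩ ^ a * F) = xr ⟨l, h⟩ ^ a * symm (l + 1) F :=
    symm_mul_of_invariant (fun w hw => by rw [map_pow, xr_invariant (by simp) w hw]) F
  have e2 : (if a = 0 then t ^ (n - l) • evSym l n G else 0) =
      if a = 0 then tr n ^ (n - l) * evSym l n G else 0 := by
    rw [Algebra.smul_def, map_pow, tr]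
  rw [symm_eq_sum h, evSym_jing h, e1, hF, e2, add_sub_cancel_right]
  simp only [map_mul, act_smul, map_pow, act_xr, swap_apply_left]
  rw [Algebra.smul_def, map_sub, map_one, ← tr, Algebra.smul_def, mul_left_comm]
  congr 1
  rw [Finset.mul_sum]
  refine Finset.sum_congr rfl fun p _ => ?_
  rw [Algebra.smul_def]
  ring

end Vertex

/-! ### Hall–Littlewood polynomials -/

section HallLittlewood

variable {n : ℕ}

/-- The monomial `x_{l+1}^{λ_1} x_{l+2}^{λ_2} ⋯`. -/
def partMonomial (l n : ℕ) (lam : List ℕ) : Rat n := ∏ i ∈ tail l n, xr i ^ lam.getD (i - l) 0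

theorem partMonomial_cons {l : ℕ} (h : l < n) (a : ℕ) (lam : List ℕ) :
    partMonomial l n (a :: lam) = xr ⟨l, h⟩ ^ a * partMonomial (l + 1) n lam := by
  rw [partMonomial, tail_eq_insert h, Finset.prod_insert (notMem_tail_succ h), partMonomial]
  congr 1
  · simp
  · refine Finset.prod_congr rfl fun i hi => ?_
    rw [mem_tail] at hi
    rw [show (i : ℕ) - l = (i - (l + 1)) + 1 by omega, List.getD_cons_succ]

/-- Each variable peeled off applies one vertex operator and costs a factor 1 - t. Positivity of the
parts excludes the correction at a = 0; the variables with exponent 0 are left to `symm_one`, whence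
the t-factorial. -/
theorem symm_partMonomial (lam : List ℕ) (hpos : ∀ a ∈ lam, 0 < a) {l : ℕ}
    (hl : l + lam.length ≤ n) :
    (1 - t) ^ lam.length • symm l (partMonomial l n lam) =
      tFactorial (n - l - lam.length) • evSym l n (hallLittlewood lam) := by
  induction lam generalizing l with
  | nil =>
    rw [partMonomial]
    simp only [List.getD_nil, pow_zero, Finset.prod_const_one, List.length_nil, one_smul]
    rw [symm_one (by simpa using hl), hallLittlewood, List.foldr_nil, map_one, Algebra.smul_def,
      mul_one, tsub_zero]
  | cons a lam ih =>
    rw [List.length_cons] at hl ⊢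
    have h : l < n := by omega
    have ht := pow_ne_zero lam.length one_sub_t_ne_zero
    have ih' := ih (fun b hb => hpos b (List.mem_cons_of_mem _ hb)) (l := l + 1) (by omega)
    have ha : a ≠ 0 := (hpos a List.mem_cons_self).ne'
    rw [partMonomial_cons h, pow_succ, mul_smul, symm_xr_pow_mul h a _
      (((1 - t) ^ lam.length)⁻¹ * tFactorial (n - (l + 1) - lam.length)) (hallLittlewood lam),
      if_neg ha, sub_zero, smul_smul, mul_inv_cancel_left₀ ht]
    · congr 2
      omega
    · rw [mul_smul, ← ih', smul_smul, inv_mul_cancel₀ ht, one_smul]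

theorem sum_macdonald (lam : List ℕ) :
    ∑ w : Equiv.Perm (Fin n), (∏ i : Fin n, xr (w i) ^ lam.getD i 0) *
      ∏ i : Fin n, ∏ j ∈ Finset.Ioi i, (xr (w i) - tr n * xr (w j)) / (xr (w i) - xr (w j)) =
    symm 0 (partMonomial 0 n lam) := by
  have h1 : young 0 n = Finset.univ := by ext; simp [mem_young]
  have h2 : tail 0 n = Finset.univ := by ext; simp [mem_tail]
  rw [symm, h1]
  refine Finset.sum_congr rfl fun w _ => ?_
  simp only [partMonomial, kernel, h2, map_mul, map_prod, map_pow, act_xr, act_kernelFactor,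
    tsub_zero]
  rfl

theorem evSym_hallLittlewood (lam : List ℕ) (hpos : ∀ a ∈ lam, 0 < a) (hn : lam.length ≤ n) :
    evSym 0 n (hallLittlewood lam) = macdonaldQ lam n := by
  have key := symm_partMonomial lam hpos (n := n) (l := 0) (by omega)
  set b : K := ∏ i ∈ lam.toFinset, ∏ j ∈ Finset.Icc 1 (lam.count i), (1 - t ^ j) with hb
  set v : K := ∏ i ∈ lam.toFinset, tFactorial (lam.count i) with hv
  -- Each factor 1 - t^j of b_λ is 1 - t times a factor of [m_i]_t!, and the positive multiplicities
  -- add up to the number of parts.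
  have hbv : b = v * (1 - t) ^ lam.length := by
    rw [← List.sum_toFinset_count_eq_length lam, ← Finset.prod_pow_eq_pow_sum, hv,
      ← Finset.prod_mul_distrib]
    refine Finset.prod_congr rfl fun i _ => ?_
    rw [tFactorial, Finset.prod_div_distrib, Finset.prod_const, Nat.card_Icc, Nat.add_sub_cancel,
      div_mul_cancel₀ _ (pow_ne_zero _ one_sub_t_ne_zero)]
  have hv0 : v ≠ 0 := Finset.prod_ne_zero_iff.2 fun i _ => tFactorial_ne_zero _
  have hf := tFactorial_ne_zero (n - lam.length)
  have hQ : macdonaldQ lam n = algebraMap K (Rat n) b *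
      ((algebraMap K (Rat n) (tFactorial (n - lam.length) * v))⁻¹ *
        symm 0 (partMonomial 0 n lam)) := by
    rw [← sum_macdonald]
    rfl
  rw [hQ, ← map_inv₀, ← mul_assoc, ← map_mul, ← Algebra.smul_def, hbv,
    show v * (1 - t) ^ lam.length * (tFactorial (n - lam.length) * v)⁻¹ =
      (tFactorial (n - lam.length))⁻¹ * (1 - t) ^ lam.length by field_simp,
    mul_smul, key, tsub_zero, smul_smul, inv_mul_cancel₀ hf, one_smul]

end HallLittlewood

/-! ### Lowering operators and partial idempotents in finitely many variables -/

section Lowering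

open Equiv

variable {n : ℕ}

theorem evRat_xInf {i : ℕ} (h : i < n) : evRat n (xInf i) = xr ⟨i, h⟩ := by
  rw [evRat_apply]
  simp only [xInf, dif_pos h]
  rfl

theorem evRat_realize_monomial (k : ℕ) (m : Fin k →₀ ℕ) (G : SymFun) :
    evRat n (realize k (MvPolynomial.monomial m G)) =
      (∏ i : Fin k, evRat n (xInf i) ^ m i) * evSym k n G := by
  rw [MvPolynomial.monomial_eq, map_mul, map_mul, mul_comm, realize, MvPolynomial.aevalTower_C,
    Finsupp.prod_fintype _ _ (fun _ => pow_zero _)]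
  simp only [map_prod, map_pow, MvPolynomial.aevalTower_X]
  rfl

theorem act_evRat_realize {k : ℕ} {w : Perm (Fin n)} (hw : w ∈ young k n) (f : Tens k) :
    act w (evRat n (realize k f)) = evRat n (realize k f) := by
  induction f using MvPolynomial.induction_on with
  | C a =>
    rw [realize, MvPolynomial.aevalTower_C]
    exact act_evSym hw a
  | add f g hf hg => rw [map_add, map_add, map_add, hf, hg]
  | mul_X f i hf =>
    rw [map_mul, map_mul, map_mul, hf, realize, MvPolynomial.aevalTower_X]
    congr 1
    by_cases h : (i : ℕ) < n
    · rw [evRat_xInf h, xr_invariant (show ((⟨i, h⟩ : Fin n) : ℕ) < k from i.2) w hw]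
    · have : evRat n (xInf i) = 0 := by
        rw [evRat_apply]
        simp [xInf, h]
      rw [this, map_zero]

theorem partialIdempotent_add_smul {l : ℕ} (hl : l ≤ n) (a b : K) (f g : Pol n) :
    partialIdempotent l n (a • f + b • g) =
      a • partialIdempotent l n f + b • partialIdempotent l n g := by
  apply toRat_injective
  rw [toRat_partialIdempotent hl, map_add, map_add]
  simp only [toRat_smul, toRat_partialIdempotent hl, symm_add, symm_smul, smul_add]
  rw [smul_comm a, smul_comm b]

/-- By `symm_symm` the inner symmetrizer contributes only the scalar `symm k 1`, which its
normalization cancels. This permits lowering one variable at a time. -/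
theorem partialIdempotent_partialIdempotent {l k : ℕ} (hlk : l ≤ k) (hk : k ≤ n) (f : Pol n) :
    partialIdempotent l n (partialIdempotent k n f) = partialIdempotent l n f := by
  apply toRat_injective
  rw [toRat_partialIdempotent (hlk.trans hk), toRat_partialIdempotent hk, symm_smul,
    symm_symm hlk, symm_one hk, mul_comm, ← Algebra.smul_def, symm_smul,
    inv_smul_smul₀ (tFactorial_ne_zero _), toRat_partialIdempotent (hlk.trans hk)]

theorem partialIdempotent_realize {k : ℕ} (hk : k ≤ n) (f : Tens k) :
    partialIdempotent k n ((realize k f).1 n) = (realize k f).1 n := by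
  apply toRat_injective
  rw [toRat_partialIdempotent hk, ← evRat_apply,
    symm_of_invariant fun w hw => act_evRat_realize hw f, symm_one hk, mul_comm,
    ← Algebra.smul_def, smul_smul, inv_mul_cancel₀ (tFactorial_ne_zero _), one_smul]

/-- The part of `f` that is constant in `x_{k+1}`, with `F[x_{k+2} + ⋯]` replaced by
`F[x_{k+1} + ⋯]`. -/
def constantPart (k : ℕ) (f : Tens (k + 1)) : Tens k :=
  ∑ m ∈ f.support, MvPolynomial.monomial
    (Finsupp.equivFunOnFinite.symm fun i : Fin k => m i.castSucc)
    (if m (Fin.last k) = 0 then f.coeff m else 0)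

theorem symm_evRat_realize_monomial {k : ℕ} (h : k < n) (m : Fin (k + 1) →₀ ℕ) (G : SymFun) :
    (1 - t) • symm k (evRat n (realize (k + 1) (MvPolynomial.monomial m G))) =
      tFactorial (n - (k + 1)) • (evRat n (realize k (MvPolynomial.monomial
        (Finsupp.equivFunOnFinite.symm fun i : Fin k => m i.castSucc) (jing (m (Fin.last k)) G))) -
      t ^ (n - k) • evRat n (realize k (MvPolynomial.monomial
        (Finsupp.equivFunOnFinite.symm fun i : Fin k => m i.castSucc)
        (if m (Fin.last k) = 0 then G else 0)))) := by
  have hx : evRat n (xInf (Fin.last k : Fin (k + 1))) = xr ⟨k, h⟩ := evRat_xInf h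
  have hinv : ∀ w ∈ young k n, act w (∏ i : Fin k, evRat n (xInf i) ^ m i.castSucc) =
      ∏ i : Fin k, evRat n (xInf i) ^ m i.castSucc := by
    intro w hw
    rw [map_prod]
    refine Finset.prod_congr rfl fun i _ => ?_
    rw [map_pow, evRat_xInf (i.2.trans h),
      xr_invariant (show ((⟨i, i.2.trans h⟩ : Fin n) : ℕ) < k from i.2) w hw]
  have hG : symm (k + 1) (evSym (k + 1) n G) = tFactorial (n - (k + 1)) • evSym (k + 1) n G := by
    rw [symm_of_invariant fun w hw => act_evSym hw G, symm_one (by omega), mul_comm,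
      ← Algebra.smul_def]
  rw [evRat_realize_monomial, Fin.prod_univ_castSucc, mul_assoc, hx]
  simp only [Fin.val_castSucc]
  rw [symm_mul_of_invariant hinv, ← mul_smul_comm, symm_xr_pow_mul h _ _ _ G hG,
    evRat_realize_monomial, evRat_realize_monomial]
  simp only [Finsupp.equivFunOnFinite_symm_apply_apply]
  rw [mul_smul_comm, mul_sub]
  congr 2
  split_ifs
  · rw [mul_smul_comm]
  · rw [map_zero, mul_zero, smul_zero]

/-- On each monomial this is the vertex recursion with a the exponent of x_{k+1}. The denominator is
what remains of [n-k]_t! after [n-k-1]_t! and the factor 1 - t cancel. Only the two scalars depend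
on n, so the limit can be read off. -/
theorem partialIdempotent_realize_succ {k : ℕ} (h : k < n) (f : Tens (k + 1)) :
    partialIdempotent k n ((realize (k + 1) f).1 n) =
      (1 - t ^ (n - k))⁻¹ • (realize k (lowerTens k f)).1 n +
        (-(t ^ (n - k) * (1 - t ^ (n - k))⁻¹)) • (realize k (constantPart k f)).1 n := by
  have e : (1 - t) • symm k (evRat n (realize (k + 1) f)) = tFactorial (n - (k + 1)) •
      (evRat n (realize k (lowerTens k f)) -
        t ^ (n - k) • evRat n (realize k (constantPart k f))) := by
    conv_lhs => rw [← MvPolynomial.support_sum_monomial_coeff f]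
    simp only [lowerTens, constantPart, map_sum, symm_sum, Finset.smul_sum,
      symm_evRat_realize_monomial h]
    rw [← Finset.sum_sub_distrib, Finset.smul_sum]
  apply toRat_injective
  rw [toRat_partialIdempotent h.le, map_add, toRat_smul, toRat_smul, ← evRat_apply, ← evRat_apply,
    ← evRat_apply]
  have h1 := one_sub_t_ne_zero
  have h2 := one_sub_t_pow_ne_zero (m := n - k) (by omega)
  have h3 := tFactorial_ne_zero (n - (k + 1))
  have e' : symm k (evRat n (realize (k + 1) f)) = (1 - t)⁻¹ • tFactorial (n - (k + 1)) •
      (evRat n (realize k (lowerTens k f)) -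
        t ^ (n - k) • evRat n (realize k (constantPart k f))) := by
    rw [← e, smul_smul, inv_mul_cancel₀ h1, one_smul]
  have hf : tFactorial (n - k) = tFactorial (n - (k + 1)) * ((1 - t ^ (n - k)) / (1 - t)) := by
    rw [show n - k = n - (k + 1) + 1 by omega, tFactorial_succ]
  rw [e', smul_smul, smul_smul, hf, smul_sub, smul_smul, sub_eq_add_neg, ← neg_smul]
  congr 2
  · field_simp
  · field_simp

end Lowering

/-! ### Limits -/

section Limits

/-- The `t`-adic valuation of `ℚ(q,t)`. -/
abbrev tVal : Valuation K ℤᵐ⁰ := (Polynomial.idealX (RatFunc ℚ)).valuation K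

/-! ### Scalar limits in the t-adic topology -/

theorem tAdicTendsto_const (c : K) : TAdicTendsto (fun _ => c) c := fun γ =>
  ⟨0, fun m _ => by rw [sub_self, map_zero]; exact γ.zero_lt⟩

theorem TAdicTendsto.congr {a b : ℕ → K} {L : K} (h : TAdicTendsto a L) (M : ℕ)
    (hab : ∀ m ≥ M, a m = b m) : TAdicTendsto b L := fun γ => by
  obtain ⟨M', hM'⟩ := h γ
  exact ⟨max M M', fun m hm => by
    rw [← hab m (le_of_max_le_left hm)]; exact hM' m (le_of_max_le_right hm)⟩

theorem TAdicTendsto.add {a b : ℕ → K} {A B : K} (ha : TAdicTendsto a A)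
    (hb : TAdicTendsto b B) : TAdicTendsto (fun m => a m + b m) (A + B) := fun γ => by
  obtain ⟨M, hM⟩ := ha γ
  obtain ⟨M', hM'⟩ := hb γ
  refine ⟨max M M', fun m hm => ?_⟩
  rw [add_sub_add_comm]
  exact Valuation.map_add_lt _ (hM m (le_of_max_le_left hm)) (hM' m (le_of_max_le_right hm))

theorem TAdicTendsto.sum {ι : Type*} (s : Finset ι) {a : ι → ℕ → K} {A : ι → K}
    (h : ∀ i ∈ s, TAdicTendsto (a i) (A i)) :
    TAdicTendsto (fun m => ∑ i ∈ s, a i m) (∑ i ∈ s, A i) := by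
  classical
  induction s using Finset.induction_on with
  | empty => simpa using tAdicTendsto_const 0
  | insert i s hi ih =>
    simp only [Finset.sum_insert hi]
    exact (h i (Finset.mem_insert_self _ _)).add
      (ih fun j hj => h j (Finset.mem_insert_of_mem hj))

theorem TAdicTendsto.const_mul {a : ℕ → K} {A : K} (h : TAdicTendsto a A) (c : K) :
    TAdicTendsto (fun m => c * a m) (c * A) := by
  rcases eq_or_ne c 0 with rfl | hc
  · simpa using tAdicTendsto_const 0
  intro γ
  have hv : tVal c ≠ 0 := (Valuation.ne_zero_iff _).2 hc
  obtain ⟨M, hM⟩ := h ((Units.mk0 _ hv)⁻¹ * γ)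
  refine ⟨M, fun m hm => ?_⟩
  have := hM m hm
  rw [← mul_sub, map_mul]
  rw [Units.val_mul, Units.val_inv_eq_inv_val, Units.val_mk0] at this
  exact (lt_inv_mul_iff₀ (zero_lt_iff.2 hv)).1 this

theorem TAdicTendsto.mul {a b : ℕ → K} {A B : K} (ha : TAdicTendsto a A)
    (hb : TAdicTendsto b B) : TAdicTendsto (fun m => a m * b m) (A * B) := by
  have h0 : TAdicTendsto (fun m => (a m - A) * (b m - B)) 0 := by
    intro γ
    obtain ⟨M, hM⟩ := ha γ
    obtain ⟨M', hM'⟩ := hb 1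
    refine ⟨max M M', fun m hm => ?_⟩
    rw [sub_zero, map_mul]
    have h1 := hM m (le_of_max_le_left hm)
    have h2 := hM' m (le_of_max_le_right hm)
    rw [Units.val_one] at h2
    exact (mul_le_of_le_one_right' h2.le).trans_lt h1
  have h1 := (h0.add (hb.const_mul A)).add ((ha.const_mul B).add (tAdicTendsto_const (-(A * B))))
  rw [show 0 + A * B + (B * A + -(A * B)) = A * B by ring] at h1
  exact h1.congr 0 fun m _ => by ring

theorem TAdicTendsto.unique {a : ℕ → K} {A B : K} (ha : TAdicTendsto a A)
    (hb : TAdicTendsto a B) : A = B := by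
  by_contra hne
  have hv : tVal (A - B) ≠ 0 := (Valuation.ne_zero_iff _).2 (sub_ne_zero.2 hne)
  have h := ((ha.const_mul (-1)).add hb) (Units.mk0 _ hv)
  obtain ⟨M, hM⟩ := h
  have := hM M le_rfl
  rw [show -1 * a M + a M - (-1 * A + B) = A - B by ring] at this
  exact lt_irrefl _ this

theorem tVal_t : tVal t = WithZero.exp (-1 : ℤ) := Polynomial.valuation_X_eq_neg_one (RatFunc ℚ)

theorem tVal_t_lt_one : tVal t < 1 := by
  rw [tVal_t, ← WithZero.exp_zero, WithZero.exp_lt_exp]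
  omega

theorem tAdicTendsto_t_pow (k : ℕ) : TAdicTendsto (fun m => t ^ (m - k)) 0 := by
  intro γ
  obtain ⟨N, hN⟩ : ∃ N : ℕ, tVal t ^ N < γ := by
    obtain ⟨z, hz⟩ : ∃ z : ℤ, (γ : ℤᵐ⁰) = WithZero.exp z :=
      ⟨WithZero.log (γ : ℤᵐ⁰), (WithZero.exp_log γ.ne_zero).symm⟩
    refine ⟨(-z).toNat + 1, ?_⟩
    rw [hz, tVal_t, ← WithZero.exp_nsmul, WithZero.exp_lt_exp]
    simp only [nsmul_eq_mul]
    omega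
  refine ⟨k + N, fun m hm => ?_⟩
  rw [sub_zero, map_pow]
  exact (pow_le_pow_right_of_le_one' tVal_t_lt_one.le (by omega)).trans_lt hN

theorem tAdicTendsto_t_pow_mul_inv (k : ℕ) :
    TAdicTendsto (fun m => t ^ (m - k) * (1 - t ^ (m - k))⁻¹) 0 := by
  intro γ
  obtain ⟨M, hM⟩ := tAdicTendsto_t_pow k γ
  -- The exponent `m - k` must be positive: then 1 - t^(m-k) has valuation 1, and inverting it does
  -- not change the estimate.
  refine ⟨max M (k + 1), fun m hm => ?_⟩
  have h1 := hM m (le_of_max_le_left hm)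
  have hm' := le_of_max_le_right hm
  have hlt : tVal (t ^ (m - k)) < 1 := by
    rw [map_pow]
    exact pow_lt_one' tVal_t_lt_one (by omega)
  rw [sub_zero] at h1 ⊢
  rw [map_mul, map_inv₀, Valuation.map_one_sub_of_lt _ hlt, inv_one, mul_one]
  exact h1

theorem tAdicTendsto_inv_one_sub (k : ℕ) :
    TAdicTendsto (fun m => (1 - t ^ (m - k))⁻¹) 1 := by
  have h := (tAdicTendsto_const 1).add (tAdicTendsto_t_pow_mul_inv k)
  rw [add_zero] at h
  refine h.congr (k + 1) fun m hm => ?_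
  have := one_sub_t_pow_ne_zero (m := m - k) (by omega)
  field_simp
  ring

/-! ### Limits of sequences of polynomials -/

theorem exists_restrict {n m : ℕ} (h : n ≤ m) :
    ∃ τ : Pol m →ₐ[K] Pol n, ∀ F : PInf, τ (F.1 m) = F.1 n := by
  induction m, h using Nat.le_induction with
  | base => exact ⟨AlgHom.id K _, fun _ => rfl⟩
  | succ m _ ih =>
    obtain ⟨τ, hτ⟩ := ih
    exact ⟨τ.comp (trunc m), fun F => by rw [AlgHom.comp_apply, F.2 m, hτ]⟩

/-- After restriction to n variables, the coefficient of a fixed monomial in f_m is a scalar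
sequence, determined by f for large m and converging to that coefficient of the limit. Uniqueness of
scalar limits applies to each coefficient. -/
theorem HasLimit.unique {m₀ : ℕ} {f : ∀ m, Pol m} {F F' : PInf} (h : HasLimit m₀ f F)
    (h' : HasLimit m₀ f F') : F = F' := by
  have key : ∀ (F : PInf), HasLimit m₀ f F → ∀ (n : ℕ) (ν : Fin n →₀ ℕ),
      ∃ b : ℕ → K, TAdicTendsto b ((F.1 n).coeff ν) ∧ ∀ m ≥ max m₀ n,
        ∀ τ : Pol m →ₐ[K] Pol n, (∀ G : PInf, τ (G.1 m) = G.1 n) → b m = (τ (f m)).coeff ν := by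
    rintro F ⟨N, h, g, a, c, -, ha, hf, rfl⟩ n ν
    refine ⟨fun m => (h.1 n).coeff ν + ∑ i, ((g i).1 n).coeff ν * a i m, ?_, ?_⟩
    · have e : MvPolynomial.coeff ν ((h + ∑ i, c i • g i : PInf).1 n) =
          (h.1 n).coeff ν + ∑ i, ((g i).1 n).coeff ν * c i := by
        let ev : PInf →ₐ[K] Pol n := (Pi.evalAlgHom K Pol n).comp PInf.val
        have hev : ∀ F : PInf, F.1 n = ev F := fun _ => rfl
        rw [hev, map_add, map_sum, MvPolynomial.coeff_add, MvPolynomial.coeff_sum]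
        congr 1
        refine Finset.sum_congr rfl fun i _ => ?_
        rw [map_smul, MvPolynomial.coeff_smul, smul_eq_mul, mul_comm]
        rfl
      rw [e]
      exact (tAdicTendsto_const _).add (TAdicTendsto.sum _ fun i _ => (ha i).const_mul _)
    · intro m hm τ hτ
      rw [hf m (le_of_max_le_left hm), map_add, map_sum, hτ, MvPolynomial.coeff_add,
        MvPolynomial.coeff_sum]
      beta_reduce
      congr 1
      refine Finset.sum_congr rfl fun i _ => ?_
      rw [map_smul, hτ, MvPolynomial.coeff_smul, smul_eq_mul, mul_comm]
  apply Subtype.ext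
  funext n
  ext ν
  obtain ⟨b, hb, hb'⟩ := key F h n ν
  obtain ⟨b₁, hb₁, hb₁'⟩ := key F' h' n ν
  refine hb.unique (hb₁.congr (max m₀ n) fun m hm => ?_)
  obtain ⟨τ, hτ⟩ := exists_restrict (le_of_max_le_right hm)
  rw [hb' m hm τ hτ, hb₁' m hm τ hτ]

/-- Polynomials lift to almost symmetric functions. -/
theorem exists_lift {m : ℕ} (p : Pol m) : ∃ F ∈ Pas, F.1 m = p := by
  refine ⟨MvPolynomial.aeval (fun i : Fin m => xInf i) p, ⟨m, ?_⟩, ?_⟩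
  · induction p using MvPolynomial.induction_on with
    | C a => rw [MvPolynomial.aeval_C]; exact Subalgebra.algebraMap_mem _ _
    | add p q hp hq => rw [map_add]; exact add_mem hp hq
    | mul_X p i hp =>
      rw [map_mul, MvPolynomial.aeval_X]
      exact mul_mem hp ⟨MvPolynomial.X i, by simp [realize]⟩
  · have : ((Pi.evalAlgHom K Pol m).comp PInf.val).comp
        (MvPolynomial.aeval fun i : Fin m => xInf i) = AlgHom.id K (Pol m) := by
      refine MvPolynomial.algHom_ext fun i => ?_
      simp [xInf]
    exact congrArg (fun φ => φ p) this

/-- Eventual convergence, in which no part outside the almost symmetric functions is needed. -/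
def AsLimit (f : ∀ m, Pol m) (F : PInf) : Prop :=
  ∃ (N : ℕ) (g : Fin N → PInf) (a : Fin N → ℕ → K) (c : Fin N → K),
    (∀ i, g i ∈ Pas) ∧ (∀ i, TAdicTendsto (a i) (c i)) ∧
    (∃ M, ∀ m ≥ M, f m = ∑ i, a i m • (g i).1 m) ∧ F = ∑ i, c i • g i

theorem asLimit_of_eventually_eq {f : ∀ m, Pol m} {F : PInf} (hF : F ∈ Pas) (M : ℕ)
    (h : ∀ m ≥ M, f m = F.1 m) : AsLimit f F :=
  ⟨1, fun _ => F, fun _ _ => 1, fun _ => 1, fun _ => hF, fun _ => tAdicTendsto_const 1,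
    ⟨M, fun m hm => by simp [h m hm]⟩, by simp⟩

theorem AsLimit.combine {f f' e : ∀ m, Pol m} {F F' : PInf} (h : AsLimit f F) (h' : AsLimit f' F')
    {b b' : ℕ → K} {β β' : K} (hb : TAdicTendsto b β) (hb' : TAdicTendsto b' β') (M : ℕ)
    (he : ∀ m ≥ M, e m = b m • f m + b' m • f' m) : AsLimit e (β • F + β' • F') := by
  obtain ⟨N, g, a, c, hg, ha, ⟨M₁, hf⟩, rfl⟩ := h
  obtain ⟨N', g', a', c', hg', ha', ⟨M₂, hf'⟩, rfl⟩ := h'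
  refine ⟨N + N', Fin.append g g', Fin.append (fun i m => b m * a i m) fun i m => b' m * a' i m,
    Fin.append (fun i => β * c i) fun i => β' * c' i, ?_, ?_, ⟨max M (max M₁ M₂), ?_⟩, ?_⟩
  · intro i
    refine Fin.addCases (fun i => ?_) (fun i => ?_) i
    · rw [Fin.append_left]; exact hg i
    · rw [Fin.append_right]; exact hg' i
  · intro i
    refine Fin.addCases (fun i => ?_) (fun i => ?_) i
    · rw [Fin.append_left, Fin.append_left]; exact hb.mul (ha i)
    · rw [Fin.append_right, Fin.append_right]; exact hb'.mul (ha' i)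
  · intro m hm
    simp only [ge_iff_le, max_le_iff] at hm
    rw [he m hm.1, hf m hm.2.1, hf' m hm.2.2, Fin.sum_univ_add]
    simp only [Fin.append_left, Fin.append_right, Finset.smul_sum, smul_smul]
  · rw [Fin.sum_univ_add]
    simp only [Fin.append_left, Fin.append_right, Finset.smul_sum, smul_smul]

theorem AsLimit.hasLimit {f : ∀ m, Pol m} {F : PInf} (h : AsLimit f F) (m₀ : ℕ) :
    HasLimit m₀ f F := by
  obtain ⟨N, g, a, c, hg, ha, ⟨M, hf⟩, rfl⟩ := h
  -- The expansion must hold for every m ≥ m₀, not just eventually. For each of the finitely many m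
  -- < M the discrepancy is lifted to an almost symmetric function, weighted by the indicator of m,
  -- which tends to 0. So neither the limit nor the part `h` is affected.
  choose r hr hr' using fun m : ℕ => exists_lift (f m - ∑ i, a i m • (g i).1 m)
  refine ⟨N + M, 0, Fin.append g fun i : Fin M => r i,
    Fin.append a fun (i : Fin M) m => if m = i then 1 else 0, Fin.append c fun _ => 0,
    ?_, ?_, ?_, ?_⟩
  · intro i
    refine Fin.addCases (fun i => ?_) (fun i => ?_) i
    · rw [Fin.append_left]; exact hg i
    · rw [Fin.append_right]; exact hr i
  · intro i
    refine Fin.addCases (fun i => ?_) (fun i => ?_) i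
    · rw [Fin.append_left, Fin.append_left]; exact ha i
    · rw [Fin.append_right, Fin.append_right]
      exact (tAdicTendsto_const 0).congr M fun m hm => (if_neg (by omega)).symm
  · intro m _
    rw [Fin.sum_univ_add]
    simp only [Fin.append_left, Fin.append_right]
    have h0 : (0 : PInf).1 m = 0 := rfl
    rw [h0, zero_add]
    by_cases hm : m < M
    · rw [Finset.sum_eq_single (⟨m, hm⟩ : Fin M)]
      · simp only [if_true, one_smul]
        rw [hr', add_sub_cancel]
      · intro i _ hi
        rw [if_neg fun e => hi (Fin.ext e.symm), zero_smul]
      · exact fun h => absurd (Finset.mem_univ _) h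
    · rw [Finset.sum_eq_zero (s := (Finset.univ : Finset (Fin M))), add_zero, hf m (by omega)]
      intro i _
      rw [if_neg (by omega), zero_smul]
  · rw [Fin.sum_univ_add]
    simp

end Limits

/-! ### Stable symmetrization as a limit -/

theorem realize_equivTens (k : ℕ) (f : PK k) : realize k (equivTens k f) = f := by
  have h : (equivTens k).symm (equivTens k f) = f := (equivTens k).symm_apply_apply f
  exact congrArg Subtype.val h

/-- Inserting ε_{l+d} before ε_l expresses ε_l(f) through ε_l of the lowered function, with
coefficient tending to 1, and ε_l of the constant part, with coefficient tending to 0. Both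
functions lie in 𝒫(l+d)⁺, so the induction hypothesis applies to both. -/
theorem asLimit_lowerTo (l d : ℕ) (f : PK (l + d)) :
    AsLimit (fun m => partialIdempotent l m (f.1.1 m)) (lowerTo l d f : PInf) := by
  induction d with
  | zero =>
    refine asLimit_of_eventually_eq ⟨l, f.2⟩ l fun m hm => ?_
    have := partialIdempotent_realize hm (equivTens l f)
    rwa [realize_equivTens] at this
  | succ d ih =>
    let g : PK (l + d) := (equivTens (l + d)).symm (constantPart (l + d) (equivTens (l + d + 1) f))
    have hb' := (tAdicTendsto_t_pow_mul_inv (l + d)).const_mul (-1)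
    have h := (ih (lower (l + d) f)).combine (ih g) (tAdicTendsto_inv_one_sub (l + d)) hb'
      (e := fun m => partialIdempotent l m (f.1.1 m)) (l + d + 1) ?_
    · rw [one_smul, mul_zero, zero_smul, add_zero] at h
      exact h
    · intro m hm
      have hk : l + d < m := hm
      have e := partialIdempotent_realize_succ hk (equivTens (l + d + 1) f)
      rw [realize_equivTens] at e
      rw [← partialIdempotent_partialIdempotent (Nat.le_add_right l d) hk.le, e,
        partialIdempotent_add_smul (by omega), neg_one_mul]
      rfl

theorem hasLimit_lowerTo (l d : ℕ) (f : Pas) (hf : (f : PInf) ∈ PK (l + d)) :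
    HasLimit (l + 1) (fun m => partialIdempotent l m (f.1.1 m)) (lowerTo l d ⟨f, hf⟩ : PInf) :=
  (asLimit_lowerTo l d ⟨f, hf⟩).hasLimit (l + 1)

theorem hasLimit_stableSymm (l : ℕ) (f : Pas) :
    HasLimit (l + 1) (fun m => partialIdempotent l m (f.1.1 m)) (stableSymm l f : PInf) :=
  hasLimit_lowerTo l _ f _

end StableLimit

end

open StableLimit

theorem proposition4p17 :
    (∀ l : ℕ,
      (∀ (d : ℕ) (f : Pas) (hf : (f : PInf) ∈ PK (l + d)),
        stableSymm l f = lowerTo l d ⟨f, hf⟩) ∧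
      (∀ A : Pas → Pas,
        HasLimitOperator (l + 1) (partialIdempotent l) A ↔
          ∀ f : Pas, (A f : PInf) = (stableSymm l f : PInf))) ∧
    (∀ lam : List ℕ, lam.Pairwise (· ≥ ·) → (∀ a ∈ lam, 0 < a) → ∀ n : ℕ, lam.length ≤ n →
      algebraMap (Pol n) (FractionRing (Pol n)) ((inAlphabet 0 (hallLittlewood lam)).1 n) =
        macdonaldQ lam n) := by
  refine ⟨fun l => ⟨fun d f hf => ?_, fun A => ⟨fun hA f => ?_, fun hA f => ?_⟩⟩,
    fun lam _ hpos n hn => evSym_hallLittlewood lam hpos hn⟩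
  -- Independence of the starting point: both composites are limits of the sequence ε_l^{(m)}(π_m
  -- f).
  · exact Subtype.ext ((hasLimit_stableSymm l f).unique (hasLimit_lowerTo l d f hf))
  · exact (hA f).unique (hasLimit_stableSymm l f)
  · rw [hA f]
    exact hasLimit_stableSymm l f
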